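/- **Theorem 1.** Let $q=3^n$, $n\ge 1$, and let $\mathcal L_q$ be the arrangement of the lines in $\mathbb P^2$ over $\mathbb F_q$, labelled by $t\in\mathbb F_q$, with normal vectors $(t,1,t^3)$; these are the lines dual to the $\mathbb F_q$-points of the smooth part of the cuspidal cubic $y^2z=x^3$. Let $M_q$ be the matroid of $\mathcal L_q$, i.e. the set of triples of distinct labels whose lines have a common point. A realization of $M_q$ over a field $K$ is an arrangement of pairwise distinct lines in $\mathbb P^2(K)$ with the same labels and the same set of concurrent triples. 1. $\mathcal L_q$ consists of $q$ distinct lines. It has exactly $\frac{q(q-1)}{6}$ triple points (points on exactly three of the lines), and every point lying on at least two of the lines is a triple point. 2. If $n\ge 3$, then $M_q$ has no realization over any field of characteristic different from $3$. 3. Let $k=\overline{\mathbb F}_3$. For a $k$-algebra $A$, an $A$-valued realization of $M_{27}$ is a family of lines in $\mathbb P^2_A$, given by normal vectors in $A^3$, with the labels of $M_{27}$, which are pairwise distinct at every point of $\operatorname{Spec}A$, and such that the determinant of the normal vectors of three distinct lines is $0$ if their triple belongs to $M_{27}$ and is a unit of $A$ otherwise. The realization space $\mathcal R(M_{27})/k$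 is the $k$-scheme representing the functor which sends $A$ to the set of $A$-valued realizations of $M_{27}$ modulo projective transformations (the action of $\mathrm{GL}_3(A)$ and rescaling of each normal vector by a unit). This scheme exists and is affine, $\mathcal R(M_{27})/k=\operatorname{Spec}R$. It has dimension $3$. It has a non-reduced embedded component of dimension $2$: some minimal primary decomposition of the zero ideal of $R$ has a member $Q$ which is not a radical ideal, such that $\sqrt Q$ is not a minimal prime of $R$ and $\dim R/Q=2$. The reduced scheme $\operatorname{Spec}(R/\sqrt{0})$ is isomorphic over $k$ to an open subscheme of a quadric of rank $3$ in $\mathbb P^4_k$, i.e. of the zero scheme of a quadratic form of rank $3$ in five variables. -/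

import Mathlib

open AlgebraicGeometry CategoryTheory MvPolynomial
open scoped LinearAlgebra.Projectivization DirectSum

noncomputable section

/-! ### Line arrangements in the projective plane over a field

A line of `ℙ²(K)` is given by its normal vector, that is, by a point of the dual plane.  The line
with normal vector `n` contains the point `P` if and only if `n ⬝ᵥ P = 0`. -/

/-- The incidence relation: the point `P` lies on the line `l`. -/
def LiesOn {K : Type*} [Field K] (P l : ℙ K (Fin 3 → K)) : Prop :=
  Projectivization.orthogonal l P

/-- The labels of the lines of the labelled arrangement `L` that pass through the point `P`. -/
def linesThrough {ι K : Type*} [Field K] (L : ι → ℙ K (Fin 3 → K)) (P : ℙ K (Fin 3 → K)) :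
    Set ι :=
  {i | LiesOn P (L i)}

/-- The matroid of a labelled line arrangement, recorded as the set of those triples of
(distinct) labels whose lines have a common point. -/
def arrangementMatroid {ι K : Type*} [Field K] (L : ι → ℙ K (Fin 3 → K)) : Set (Set ι) :=
  {s | s.ncard = 3 ∧ ∃ P : ℙ K (Fin 3 → K), ∀ i ∈ s, LiesOn P (L i)}

/-- `L` is a realization of the matroid `M` over the field `K`: a labelled arrangement of
pairwise distinct lines with matroid `M`. -/
def Realizes {ι K : Type*} [Field K] (L : ι → ℙ K (Fin 3 → K)) (M : Set (Set ι)) : Prop :=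
  Function.Injective L ∧ arrangementMatroid L = M

/-- The arrangement `𝓛_q` (`q = #F`): the lines dual to the `F`-points `(t : 1 : t³)`, `t ∈ F`, of
the smooth part of the cuspidal cubic `y² z = x³` (its only point with `y = 0` is the cusp). -/
def cuspidalArrangement (F : Type*) [Field F] (t : F) : ℙ F (Fin 3 → F) :=
  Projectivization.mk F ![t, 1, t ^ 3] (fun h => one_ne_zero (congrFun h 1))

/-- The matroid `M_q` (`q = #F`) of the arrangement `𝓛_q`. -/
def cuspidalMatroid (F : Type*) [Field F] : Set (Set F) :=
  arrangementMatroid (cuspidalArrangement F)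

/-! ### The realization space

The realizations of `M` form a functor on commutative rings: the `A`-valued realizations are the
families of lines in the projective plane over `A` that are pairwise distinct at every point of
`Spec A`, such that the lines labelled by a triple of `M` are concurrent, and those labelled by a
triple outside `M` are concurrent at no point of `Spec A`.  The realization space is the scheme
that represents the quotient of this functor by projective transformations. -/

/-- The family `v` of normal vectors defines an `A`-valued realization of `M`. -/
structure IsRealization {ι : Type*} (M : Set (Set ι)) {A : Type*} [CommRing A]
    (v : ι → Fin 3 → A) : Prop where
  /-- the lines are pairwise distinct at every point: the `2 × 2` minors generate the unit
  ideal -/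
  distinct : ∀ i j, i ≠ j → Ideal.span (Set.range (crossProduct (v i) (v j))) = ⊤
  /-- triples in `M` are concurrent -/
  concurrent : ∀ i j l, i ≠ j → j ≠ l → i ≠ l → ({i, j, l} : Set ι) ∈ M →
    (Matrix.of ![v i, v j, v l]).det = 0
  /-- triples not in `M` are concurrent at no point -/
  nonconcurrent : ∀ i j l, i ≠ j → j ≠ l → i ≠ l → ({i, j, l} : Set ι) ∉ M →
    IsUnit (Matrix.of ![v i, v j, v l]).det

/-- Two families of normal vectors define the same labelled line arrangement up to a projective
transformation. -/
def ProjectivelyEquivalent {ι A : Type*} [CommRing A] (v w : ι → Fin 3 → A) : Prop :=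
  ∃ (g : GL (Fin 3) A) (c : ι → Aˣ), ∀ i, w i = (c i : A) • (g : Matrix _ _ A).mulVec (v i)

/-- The affine `k`-scheme `Spec R` is the realization space of `M` over `k`: it represents the
functor sending a `k`-algebra `A` to the set of `A`-valued realizations of `M` modulo projective
transformations.  That is, there is a universal realization `u` over `R`, of which
every realization over every `k`-algebra is, up to projective transformations, the
specialization by a unique homomorphism. -/
def IsRealizationSpace.{u, w} {ι : Type w} (k : Type u) [Field k] (M : Set (Set ι))
    (R : Type u) [CommRing R] [Algebra k R] : Prop :=
  ∃ u : ι → Fin 3 → R, IsRealization M u ∧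
    ∀ (A : Type u) [CommRing A] [Algebra k A] (v : ι → Fin 3 → A), IsRealization M v →
      ∃! φ : R →ₐ[k] A, ProjectivelyEquivalent (fun i x => φ (u i x)) v

/-- `Q` is a component of `Spec R` that is embedded (also called immersed): a member of
some minimal primary decomposition of the zero ideal of `R`, whose radical is not a minimal prime
of `R`. -/
def IsEmbeddedComponent {R : Type*} [CommRing R] (Q : Ideal R) : Prop :=
  (∃ t : Finset (Ideal R), Submodule.IsMinimalPrimaryDecomposition (⊥ : Ideal R) t ∧ Q ∈ t) ∧
    Q.radical ∉ minimalPrimes R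

/-! ### Quadrics in projective space -/

section Quadric

variable {k : Type*} [Field k] {n : ℕ}

/-- The quadratic form `∑ S i j xᵢ xⱼ` with matrix `S`. -/
def quadraticPoly (S : Matrix (Fin n) (Fin n) k) : MvPolynomial (Fin n) k :=
  ∑ i, ∑ j, C (S i j) * (X i * X j)

/-- The homogeneous coordinate ring `k[x₀, …] / (∑ S i j xᵢ xⱼ)` of the quadric. -/
abbrev QuadricRing (S : Matrix (Fin n) (Fin n) k) : Type _ :=
  MvPolynomial (Fin n) k ⧸ Ideal.span {quadraticPoly S}

/-- The grading of the homogeneous coordinate ring by degree. -/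
def quadricGrading (S : Matrix (Fin n) (Fin n) k) (d : ℕ) : Submodule k (QuadricRing S) :=
  (homogeneousSubmodule (Fin n) k d).map
    (Ideal.Quotient.mkₐ k (Ideal.span {quadraticPoly S})).toLinearMap

theorem quadraticPoly_isHomogeneous (S : Matrix (Fin n) (Fin n) k) :
    (quadraticPoly S).IsHomogeneous 2 := by
  refine IsHomogeneous.sum _ _ _ fun i _ => IsHomogeneous.sum _ _ _ fun j _ => ?_
  simpa using (isHomogeneous_C (Fin n) (S i j)).mul
    ((isHomogeneous_X k i).mul (isHomogeneous_X k j))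

instance quadricGrading.gradedMonoid (S : Matrix (Fin n) (Fin n) k) :
    SetLike.GradedMonoid (quadricGrading S) where
  one_mem := ⟨1, isHomogeneous_one _ _, map_one (Ideal.Quotient.mkₐ k _)⟩
  mul_mem := by
    rintro i j _ _ ⟨a, ha, rfl⟩ ⟨b, hb, rfl⟩
    exact ⟨a * b, IsHomogeneous.mul ha hb, map_mul (Ideal.Quotient.mkₐ k _) _ _⟩

/-- Sends a polynomial to the family of the classes of its homogeneous components. -/
def quadricDecomposeAux (S : Matrix (Fin n) (Fin n) k) :
    MvPolynomial (Fin n) k →ₐ[k] ⨁ d, quadricGrading S d :=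
  aeval fun i => DirectSum.of (fun d => quadricGrading S d) 1
    ⟨Ideal.Quotient.mkₐ k _ (X i), X i, isHomogeneous_X k i, rfl⟩

theorem quadricGrading_of_congr (S : Matrix (Fin n) (Fin n) k) {d e : ℕ} {x y : QuadricRing S}
    (hx : x ∈ quadricGrading S d) (hy : y ∈ quadricGrading S e) (hde : d = e) (hxy : x = y) :
    DirectSum.of (fun d => quadricGrading S d) d ⟨x, hx⟩ =
      DirectSum.of (fun d => quadricGrading S d) e ⟨y, hy⟩ := by
  subst hde hxy
  rfl

theorem quadricDecomposeAux_monomial (S : Matrix (Fin n) (Fin n) k) (s : Fin n →₀ ℕ) (a : k) :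
    ∃ (d : ℕ) (hp : (monomial s a).IsHomogeneous d),
      quadricDecomposeAux S (monomial s a) = DirectSum.of (fun d => quadricGrading S d) d
        ⟨Ideal.Quotient.mkₐ k _ (monomial s a), monomial s a, hp, rfl⟩ := by
  refine induction_on_monomial (motive := fun p => ∃ (d : ℕ) (hp : p.IsHomogeneous d),
    quadricDecomposeAux S p = DirectSum.of (fun d => quadricGrading S d) d
      ⟨Ideal.Quotient.mkₐ k _ p, p, hp, rfl⟩) ?_ ?_ s a
  · intro a
    refine ⟨0, isHomogeneous_C _ a, ?_⟩
    refine ((quadricDecomposeAux S).commutes a).trans ?_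
    rw [DirectSum.algebraMap_apply]
    exact quadricGrading_of_congr S _ _ rfl ((Ideal.Quotient.mkₐ k _).commutes a).symm
  · rintro p i ⟨d, hp, h⟩
    refine ⟨d + 1, hp.mul (isHomogeneous_X k i), ?_⟩
    rw [map_mul, h, quadricDecomposeAux, aeval_X, DirectSum.of_mul_of]
    exact quadricGrading_of_congr S _ _ rfl (map_mul (Ideal.Quotient.mkₐ k _) _ _).symm

theorem quadricDecomposeAux_of (S : Matrix (Fin n) (Fin n) k) (d : ℕ)
    (p : MvPolynomial (Fin n) k) (hp : p.IsHomogeneous d) :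
    quadricDecomposeAux S p = DirectSum.of (fun d => quadricGrading S d) d
      ⟨Ideal.Quotient.mkₐ k _ p, p, hp, rfl⟩ := by
  have key : ∀ s ∈ p.support, ∃ x : quadricGrading S d,
      (x : QuadricRing S) = Ideal.Quotient.mkₐ k _ (monomial s (coeff s p)) ∧
      quadricDecomposeAux S (monomial s (coeff s p)) =
        DirectSum.of (fun d => quadricGrading S d) d x := by
    intro s hs
    have hne : coeff s p ≠ 0 := mem_support_iff.mp hs
    obtain ⟨e, he, h⟩ := quadricDecomposeAux_monomial S s (coeff s p)
    have hd : (monomial s (coeff s p)).IsHomogeneous d :=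
      isHomogeneous_monomial _ (by rw [Finsupp.degree_eq_weight_one]; exact hp hne)
    have hed : e = d := he.inj_right hd (by simpa using hne)
    exact ⟨⟨_, _, hd, rfl⟩, rfl, h.trans (quadricGrading_of_congr S _ _ hed rfl)⟩
  choose! x hx hx' using key
  conv_lhs => rw [p.as_sum, map_sum, Finset.sum_congr rfl hx', ← map_sum]
  congr 1
  apply Subtype.ext
  rw [AddSubmonoidClass.coe_finsetSum, Finset.sum_congr rfl hx, ← map_sum, ← p.as_sum]

instance quadricGrading.gradedAlgebra (S : Matrix (Fin n) (Fin n) k) :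
    GradedAlgebra (quadricGrading S) :=
  GradedAlgebra.ofAlgHom _
    (Ideal.Quotient.liftₐ _ (quadricDecomposeAux S) (by
      have h0 : quadricDecomposeAux S (quadraticPoly S) = 0 := by
        rw [quadricDecomposeAux_of S 2 _ (quadraticPoly_isHomogeneous S)]
        refine (congrArg _ (Subtype.ext ?_)).trans
          (map_zero (DirectSum.of (fun d => quadricGrading S d) 2))
        exact Ideal.Quotient.eq_zero_iff_mem.mpr (Ideal.mem_span_singleton_self _)
      intro a ha
      obtain ⟨b, rfl⟩ := Ideal.mem_span_singleton'.mp ha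
      rw [map_mul, h0, mul_zero]))
    (by
      apply Ideal.Quotient.algHom_ext
      apply MvPolynomial.algHom_ext
      intro i
      change DirectSum.coeAlgHom (quadricGrading S) (quadricDecomposeAux S (X i)) =
        Ideal.Quotient.mkₐ k _ (X i)
      rw [quadricDecomposeAux, aeval_X]
      exact DirectSum.coeAlgHom_of _ _ _)
    (by
      rintro d ⟨_, p, hp, rfl⟩
      exact quadricDecomposeAux_of S d p hp)

/-- The quadric `∑ S i j xᵢ xⱼ = 0` in `ℙⁿ⁻¹`, as a scheme. -/
def projQuadric (S : Matrix (Fin n) (Fin n) k) : Scheme :=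
  Proj (quadricGrading S)

/-- The structure morphism of the quadric to `Spec k`. -/
def projQuadricToSpec (S : Matrix (Fin n) (Fin n) k) :
    projQuadric S ⟶ Spec (CommRingCat.of k) :=
  Proj.toSpecZero (quadricGrading S) ≫
    Spec.map (CommRingCat.ofHom (algebraMap k (quadricGrading S 0)))

end Quadric

end

/-!
Three distinct points `(t, 1, t³)` of the cuspidal cubic are collinear if and only if their
parameters add up to zero (`triple_mem_cuspidalMatroid_iff`).  In characteristic `3` the parameters
`s ≠ t` determine a third one `-s - t` different from both, which gives the triple points.  It also
shows that `M_q` is the truncation to rank `3` of the affine space `AG(n, 3)` on the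
`𝔽₃`-vector space `F`: three labels are dependent if and only if they form an affine line.

*Characteristic different from three.*  It suffices to treat `AG(3, 3)`, embedded in `F`.  Fix a
line `ℓ` of it.  In a realization each parallel line `q + ℓ` meets `ℓ` in a point whose coordinate is
a root of `x² - x + 1`, and the coordinates for `q + ℓ` and `-q + ℓ` are different roots, the
discriminant being `-3` (`slope_neg`).  Hence of the eight lines parallel to `ℓ` four, one of each
pair `±q + ℓ`, pass through the same point of `ℓ`, and three of these are always coplanar; but three
parallel coplanar lines are never concurrent (`eq_zero_of_parallel`).

*Characteristic three.*  Over any ring, scale the vectors so that they add up to zero on all lines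
through the origin.  Then each affine plane through the origin has a one-parameter family of
realizations, the parameter having square zero (`exists_sq_zero_of_affinePlane`).  Comparing the
planes in `AG(3, 3)` shows that all the parameters are multiples of a single one, `ε`, and that
`ε * w = 0`, where `w = 0` is the condition that the realization modulo `ε` comes from an affine
map to the plane rather than a general projection
(`GluingEquations.eq_of_sq_eq_zero`, by Nakayama's lemma).  After a projective transformation the
realization is `normalForm`, with parameters `u, v, w, ε` that are unique (`exists_normalForm`,
`normalForm_unique`) and subject only to `ε² = 0`, `ε w = 0` and an open non-degeneracy condition.
So the realization space is the spectrum of the trivial square-zero extension of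
`P = k[u, v, w]_f` by `P ⧸ (w)` (`isRealizationSpace_realizationRing`).

In this ring the zero ideal is the intersection of the nilradical, with quotient `P`, and of the
ideal generated by `w`, with quotient the dual numbers over `P ⧸ (w)`; the second is primary, not
radical, and embedded (`TrivSqZeroExt.isEmbeddedComponent_extendedIdeal`).  The reduction `Spec P`
is a principal open subset of affine `3`-space, which is the chart `x₀ ≠ 0` of the rank `3` quadric
`x₂² = x₀ x₁` in `ℙ⁴` (`exists_isOpenImmersion_projQuadric`).
-/

/-! ### Concurrency as the vanishing of a determinant -/

theorem liesOn_mk_iff {K : Type*} [Field K] {n p : Fin 3 → K} (hn : n ≠ 0) (hp : p ≠ 0) :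
    LiesOn (Projectivization.mk K p hp) (Projectivization.mk K n hn) ↔ n ⬝ᵥ p = 0 :=
  Projectivization.orthogonal_mk hn hp

theorem mem_linesThrough {ι K : Type*} [Field K] {L : ι → ℙ K (Fin 3 → K)}
    {P : ℙ K (Fin 3 → K)} {i : ι} :
    i ∈ linesThrough L P ↔ Projectivization.orthogonal (L i) P :=
  Iff.rfl

theorem exists_liesOn_iff_det_eq_zero {K : Type*} [Field K] {a b c : Fin 3 → K} (ha : a ≠ 0)
    (hb : b ≠ 0) (hc : c ≠ 0) :
    (∃ P : ℙ K (Fin 3 → K), LiesOn P (Projectivization.mk K a ha) ∧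
      LiesOn P (Projectivization.mk K b hb) ∧ LiesOn P (Projectivization.mk K c hc)) ↔
      (Matrix.of ![a, b, c]).det = 0 := by
  rw [← Matrix.exists_mulVec_eq_zero_iff]
  constructor
  · rintro ⟨P, h⟩
    induction P with | h p hp =>
    simp only [liesOn_mk_iff] at h
    refine ⟨p, hp, ?_⟩
    ext i
    fin_cases i
    exacts [h.1, h.2.1, h.2.2]
  · rintro ⟨p, hp, h⟩
    refine ⟨Projectivization.mk K p hp, ?_⟩
    simp only [liesOn_mk_iff]
    exact ⟨congrFun h 0, congrFun h 1, congrFun h 2⟩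

theorem triple_mem_arrangementMatroid_iff {ι K : Type*} [Field K] {L : ι → ℙ K (Fin 3 → K)}
    {i j l : ι} (hij : i ≠ j) (hjl : j ≠ l) (hil : i ≠ l) :
    {i, j, l} ∈ arrangementMatroid L ↔
      ∃ P : ℙ K (Fin 3 → K), LiesOn P (L i) ∧ LiesOn P (L j) ∧ LiesOn P (L l) := by
  have h3 : ({i, j, l} : Set ι).ncard = 3 := Set.ncard_eq_three.2 ⟨i, j, l, hij, hil, hjl, rfl⟩
  simp [arrangementMatroid, h3]

theorem triple_mem_arrangementMatroid_iff_det {ι K : Type*} [Field K]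
    {L : ι → ℙ K (Fin 3 → K)} {i j l : ι} (hij : i ≠ j) (hjl : j ≠ l) (hil : i ≠ l) :
    {i, j, l} ∈ arrangementMatroid L ↔
      (Matrix.of ![(L i).rep, (L j).rep, (L l).rep]).det = 0 := by
  rw [triple_mem_arrangementMatroid_iff hij hjl hil, ← exists_liesOn_iff_det_eq_zero
    (L i).rep_nonzero (L j).rep_nonzero (L l).rep_nonzero]
  simp only [Projectivization.mk_rep]

/-! ### The lines dual to the points of the cuspidal cubic -/

theorem cuspidal_det {F : Type*} [CommRing F] (i j l : F) :
    (Matrix.of ![![i, 1, i ^ 3], ![j, 1, j ^ 3], ![l, 1, l ^ 3]]).det =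
      (i - j) * (j - l) * (l - i) * -(i + j + l) := by
  simp [Matrix.det_fin_three]
  ring

theorem cuspidalArrangement_injective (F : Type*) [Field F] :
    Function.Injective (cuspidalArrangement F) := by
  intro s t h
  rw [cuspidalArrangement, cuspidalArrangement, Projectivization.mk_eq_mk_iff'] at h
  obtain ⟨a, ha⟩ := h
  have h1 := congrFun ha 1
  have h0 := congrFun ha 0
  simp at h0 h1
  rw [← h0, h1, one_mul]

/-- On the smooth part of the cuspidal cubic three distinct points are collinear if and only if
their parameters add up to zero. -/
theorem triple_mem_cuspidalMatroid_iff {F : Type*} [Field F] {i j l : F} (hij : i ≠ j)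
    (hjl : j ≠ l) (hil : i ≠ l) : {i, j, l} ∈ cuspidalMatroid F ↔ i + j + l = 0 := by
  rw [cuspidalMatroid, triple_mem_arrangementMatroid_iff hij hjl hil]
  simp only [cuspidalArrangement]
  rw [exists_liesOn_iff_det_eq_zero, cuspidal_det]
  simp only [mul_eq_zero, sub_eq_zero, hij, hjl, hil.symm, neg_eq_zero, false_or]

/-! ### Counting the triple points -/

theorem charP_three_of_card {F : Type*} [Field F] {n : ℕ}
    (hF : Nat.card F = 3 ^ n) : CharP F 3 := by
  have : Finite F := Nat.finite_of_card_ne_zero (by rw [hF]; positivity)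
  have := Fintype.ofFinite F
  rw [Nat.card_eq_fintype_card] at hF
  have : Fact (Nat.Prime 3) := ⟨Nat.prime_three⟩
  exact charP_of_card_eq_prime_pow hF

/-- A point on two of the lines of `𝓛_q` lies on exactly one further line: the parameters add up
to zero. -/
theorem linesThrough_cuspidalArrangement {F : Type*} [Field F] [CharP F 3]
    {P : ℙ F (Fin 3 → F)} {s t : F} (hst : s ≠ t)
    (hs : s ∈ linesThrough (cuspidalArrangement F) P)
    (ht : t ∈ linesThrough (cuspidalArrangement F) P) :
    linesThrough (cuspidalArrangement F) P = {s, t, -s - t} := by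
  have h3 : (3 : F) = 0 := by exact_mod_cast CharP.cast_eq_zero F 3
  apply Set.Subset.antisymm
  · intro r hr
    by_cases hrs : r = s
    · simp [hrs]
    by_cases hrt : r = t
    · simp [hrt]
    have hmem : {s, t, r} ∈ cuspidalMatroid F :=
      (triple_mem_arrangementMatroid_iff hst (Ne.symm hrt) (Ne.symm hrs)).2 ⟨P, hs, ht, hr⟩
    rw [triple_mem_cuspidalMatroid_iff hst (Ne.symm hrt) (Ne.symm hrs)] at hmem
    right; right
    simp only [Set.mem_singleton_iff]
    linear_combination hmem
  · rintro r (rfl | rfl | rfl)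
    · exact hs
    · exact ht
    · induction P with | h p hp =>
      simp only [linesThrough, cuspidalArrangement, Set.mem_ofPred_eq, liesOn_mk_iff,
        dotProduct, Fin.sum_univ_three] at hs ht ⊢
      simp only [Matrix.cons_val_zero, Matrix.cons_val_one, Matrix.cons_val] at hs ht ⊢
      linear_combination -hs - ht + (p 1 - (s ^ 2 * t + s * t ^ 2) * p 2) * h3

theorem ncard_linesThrough_cuspidalArrangement {F : Type*} [Field F] [CharP F 3]
    {P : ℙ F (Fin 3 → F)} (h : 2 ≤ (linesThrough (cuspidalArrangement F) P).ncard) :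
    (linesThrough (cuspidalArrangement F) P).ncard = 3 := by
  have h3 : (3 : F) = 0 := by exact_mod_cast CharP.cast_eq_zero F 3
  obtain ⟨s, hs, t, ht, hst⟩ := (Set.one_lt_ncard_iff_nontrivial_and_finite.1 h).1
  rw [linesThrough_cuspidalArrangement hst hs ht]
  refine Set.ncard_eq_three.2 ⟨s, t, _, hst, fun h => hst ?_, fun h => hst ?_, rfl⟩
  · linear_combination -h + s * h3
  · linear_combination h - t * h3

theorem card_triplePoints {F : Type*} [Field F] [CharP F 3] [Finite F] :
    6 * {P | (linesThrough (cuspidalArrangement F) P).ncard = 3}.ncard =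
      Nat.card F * (Nat.card F - 1) := by
  classical
  have := Fintype.ofFinite F
  have hinj := cuspidalArrangement_injective F
  let f : F × F → ℙ F (Fin 3 → F) := fun x =>
    Projectivization.cross (cuspidalArrangement F x.1) (cuspidalArrangement F x.2)
  have hf : ∀ s t, s ≠ t → s ∈ linesThrough (cuspidalArrangement F) (f (s, t)) ∧
      t ∈ linesThrough (cuspidalArrangement F) (f (s, t)) := fun s t h =>
    ⟨Projectivization.orthogonal_cross_left (hinj.ne h),
      Projectivization.orthogonal_cross_right (hinj.ne h)⟩
  have huniq : ∀ s t P, s ≠ t → s ∈ linesThrough (cuspidalArrangement F) P →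
      t ∈ linesThrough (cuspidalArrangement F) P → f (s, t) = P := fun s t P h hs ht =>
    (Configuration.ofField.eq_or_eq_of_orthogonal (mem_linesThrough.1 (hf s t h).1)
      (mem_linesThrough.1 (hf s t h).2) (mem_linesThrough.1 hs)
      (mem_linesThrough.1 ht)).resolve_left (hinj.ne h)
  let T := (Finset.univ : Finset F).offDiag.image f
  have hT : {P | (linesThrough (cuspidalArrangement F) P).ncard = 3} = T := by
    ext P
    simp only [Set.mem_ofPred_eq, T, Finset.coe_image, Set.mem_image, Finset.mem_coe,
      Finset.mem_offDiag, Finset.mem_univ, true_and, Prod.exists]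
    constructor
    · intro h
      obtain ⟨s, t, r, hst, -, -, he⟩ := Set.ncard_eq_three.1 h
      exact ⟨s, t, hst, huniq s t P hst (by simp [he]) (by simp [he])⟩
    · rintro ⟨s, t, hst, rfl⟩
      refine ncard_linesThrough_cuspidalArrangement
        ((Set.one_lt_ncard_iff_nontrivial_and_finite).2 ⟨?_, Set.toFinite _⟩)
      exact ⟨s, (hf s t hst).1, t, (hf s t hst).2, hst⟩
  have hfib : ∀ P ∈ T, ((Finset.univ : Finset F).offDiag.filter (f · = P)).card = 6 := by
    intro P hP
    have h3 : (linesThrough (cuspidalArrangement F) P).ncard = 3 := by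
      have : P ∈ (T : Set _) := hP
      rwa [← hT] at this
    have : (Finset.univ : Finset F).offDiag.filter (f · = P) =
        (linesThrough (cuspidalArrangement F) P).toFinset.offDiag := by
      ext ⟨s, t⟩
      simp only [Finset.mem_filter, Finset.mem_offDiag, Finset.mem_univ, true_and,
        Set.mem_toFinset]
      constructor
      · rintro ⟨h, rfl⟩
        exact ⟨(hf s t h).1, (hf s t h).2, h⟩
      · rintro ⟨hs, ht, h⟩
        exact ⟨h, huniq s t P h hs ht⟩
    rw [this, Finset.offDiag_card, ← Set.ncard_eq_toFinset_card', h3]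
  rw [hT, Set.ncard_coe_finset, mul_comm, ← smul_eq_mul, ← Finset.sum_const,
    ← Finset.sum_congr rfl hfib, ← Finset.card_eq_sum_card_image, Finset.offDiag_card,
    Finset.card_univ, Nat.card_eq_fintype_card, Nat.mul_sub_one]

/-! ### Determinants of triples of vectors -/

/-- The determinant of three vectors. -/
abbrev det3 {A : Type*} [CommRing A] (a b c : Fin 3 → A) : A := (Matrix.of ![a, b, c]).det

section Det

variable {A : Type*} [CommRing A]

theorem det3_apply (a b c : Fin 3 → A) :
    det3 a b c = a 0 * b 1 * c 2 - a 0 * b 2 * c 1 - a 1 * b 0 * c 2 + a 1 * b 2 * c 0 +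
      a 2 * b 0 * c 1 - a 2 * b 1 * c 0 := by
  exact Matrix.det_fin_three _

theorem det3_smul (r s t : A) (a b c : Fin 3 → A) :
    det3 (r • a) (s • b) (t • c) = r * s * t * det3 a b c := by
  simp only [det3_apply, Pi.smul_apply, smul_eq_mul]
  ring

theorem det3_mulVec (g : Matrix (Fin 3) (Fin 3) A) (a b c : Fin 3 → A) :
    det3 (g.mulVec a) (g.mulVec b) (g.mulVec c) = g.det * det3 a b c := by
  have h : Matrix.of ![g.mulVec a, g.mulVec b, g.mulVec c] =
      Matrix.of ![a, b, c] * g.transpose := by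
    ext i j
    rw [Matrix.mul_apply_eq_vecMul, Matrix.vecMul_transpose]
    fin_cases i <;> rfl
  rw [det3, h, Matrix.det_mul, Matrix.det_transpose, mul_comm]

theorem map_det3 {B : Type*} [CommRing B] (f : A →+* B) (a b c : Fin 3 → A) :
    f (det3 a b c) = det3 (f ∘ a) (f ∘ b) (f ∘ c) := by
  simp only [det3_apply, map_add, map_sub, map_mul, Function.comp]

/-- Cramer's rule. -/
theorem det3_smul_eq (a b c e : Fin 3 → A) :
    det3 a b c • e = det3 e b c • a + det3 a e c • b + det3 a b e • c := by
  ext i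
  fin_cases i <;>
  · simp only [det3_apply, Pi.smul_apply, Pi.add_apply, smul_eq_mul]
    simp
    ring

theorem exists_eq_of_isUnit_det3 {a b c : Fin 3 → A} (h : IsUnit (det3 a b c))
    (e : Fin 3 → A) : ∃ x y z : A, e = x • a + y • b + z • c := by
  obtain ⟨r, hr⟩ := h.exists_left_inv
  refine ⟨r * det3 e b c, r * det3 a e c, r * det3 a b e, ?_⟩
  rw [mul_smul, mul_smul, mul_smul, ← smul_add, ← smul_add, ← det3_smul_eq, smul_smul, hr,
    one_smul]

end Det

/-! ### Realizations of the affine plane over `𝔽₃` -/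

/-- In characteristic `3` the realizations of the affine plane `AG(2, 3)` form a double point.
Normalized so that the vectors on every line through the origin add up to zero, the nine points
are `o`, `o ± a`, `o ± b`, `o ± E`, `o ± F`, where `E` and `F` stand for `a + b` and `a - b`; these
identities hold up to a parameter of square zero. -/
theorem exists_sq_zero_of_affinePlane {A : Type*} [CommRing A] (h3 : (3 : A) = 0)
    {o a b E F : Fin 3 → A} (hu : IsUnit (det3 o a b))
    (h₁ : det3 (o + a) (o + b) (o - E) = 0) (h₂ : det3 (o - a) (o - b) (o + E) = 0)
    (h₃ : det3 (o + a) (o - b) (o - F) = 0) (h₄ : det3 (o - a) (o + b) (o + F) = 0)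
    (h₅ : det3 (o + a) (o + E) (o + F) = 0) (h₆ : det3 (o + b) (o + E) (o - F) = 0) :
    ∃ ε : A, ε ^ 2 = 0 ∧ E = (1 + ε) • a + (1 - ε) • b ∧ F = (1 - ε) • a - (1 + ε) • b := by
  obtain ⟨e₀, e₁, e₂, rfl⟩ := exists_eq_of_isUnit_det3 hu E
  obtain ⟨f₀, f₁, f₂, rfl⟩ := exists_eq_of_isUnit_det3 hu F
  have cancel : ∀ {s : A}, s * det3 o a b = 0 → s = 0 := fun h => (hu.mul_left_eq_zero).1 h
  have k₁ : 1 - e₀ + e₁ + e₂ = 0 := cancel (h₁ ▸ by simp [det3_apply]; ring)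
  have k₂ : 1 + e₀ + e₁ + e₂ = 0 := cancel (h₂ ▸ by simp [det3_apply]; ring)
  have k₃ : -(1 - f₀ + f₁ - f₂) = 0 := cancel (h₃ ▸ by simp [det3_apply]; ring)
  have k₄ : -(1 + f₀ + f₁ - f₂) = 0 := cancel (h₄ ▸ by simp [det3_apply]; ring)
  have k₅ : e₁ * f₂ - e₂ * f₁ - (1 + e₀) * f₂ + e₂ * (1 + f₀) = 0 :=
    cancel (h₅ ▸ by simp [det3_apply]; ring)
  have k₆ : e₂ * f₁ - e₁ * f₂ - (1 + e₀) * f₁ - e₁ * (1 - f₀) = 0 :=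
    cancel (h₆ ▸ by simp [det3_apply]; ring)
  have he₀ : e₀ = 0 := by linear_combination k₁ - k₂ + e₀ * h3
  have hf₀ : f₀ = 0 := by linear_combination -k₃ + k₄ + f₀ * h3
  subst he₀ hf₀
  have he₂ : e₂ = -1 - e₁ := by linear_combination k₁
  have hf₂ : f₂ = 1 + f₁ := by linear_combination k₃
  subst he₂ hf₂
  have hf₁ : f₁ = 2 - e₁ := by linear_combination k₅ + k₆ + (f₁ + e₁) * h3
  subst hf₁
  refine ⟨e₁ - 1, by linear_combination -k₆ + (e₁ ^ 2 - 2 * e₁ - 1) * h3, ?_, ?_⟩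
  · rw [show -1 - e₁ = 1 - (e₁ - 1) by linear_combination -h3]
    module
  · rw [show 1 + (2 - e₁) = -e₁ by linear_combination h3]
    module

/-! ### Gluing the realizations of the planes through the origin -/

/-- The equations between the parameters `e 0, …, e 7` of the eight planes spanned by
`(e₁, e₂)`, `(e₁, e₃)`, `(e₂, e₃)`, `(e₁ + e₂, e₃)`, `(e₁, e₂ + e₃)`, `(e₁ + e₃, e₂)`,
`(e₁, e₂ - e₃)`, `(e₁ - e₃, e₂)` which say that the different planes through `e₁ + e₂ + e₃` and
through `e₁ + e₂ - e₃` give the same point there; the vectors of `e₁`, `e₂`, `e₃` are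
`(1, 0, 0)`, `(0, 1, 0)`, `(u, v, w)`. -/
structure GluingEquations {A : Type*} [CommRing A] (u v w : A) (e : Fin 8 → A) : Prop where
  eq₁ : (1 + e 3) * (1 + e 0) + (1 - e 3) * u = (1 + e 4) + (1 - e 4) * (1 - e 2) * u
  eq₂ : (1 + e 3) * (1 - e 0) + (1 - e 3) * v = (1 - e 4) * (1 + e 2) + (1 - e 4) * (1 - e 2) * v
  eq₃ : (1 - e 3) * w = (1 - e 4) * (1 - e 2) * w
  eq₄ : (1 + e 3) * (1 + e 0) + (1 - e 3) * u = (1 + e 5) * (1 + e 1) + (1 + e 5) * (1 - e 1) * u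
  eq₅ : (1 + e 3) * (1 - e 0) + (1 - e 3) * v = (1 - e 5) + (1 + e 5) * (1 - e 1) * v
  eq₆ : (1 - e 3) * (1 + e 0) - (1 + e 3) * u = (1 + e 6) - (1 - e 6) * (1 + e 2) * u
  eq₇ : (1 - e 3) * (1 - e 0) - (1 + e 3) * v = (1 - e 6) * (1 - e 2) - (1 - e 6) * (1 + e 2) * v
  eq₈ : (1 - e 3) * (1 + e 0) - (1 + e 3) * u = (1 + e 7) * (1 - e 1) - (1 + e 7) * (1 + e 1) * u
  eq₉ : (1 - e 3) * (1 - e 0) - (1 + e 3) * v = (1 - e 7) - (1 + e 7) * (1 + e 1) * v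

/-- The solution of the linearized gluing equations is `e = e 0 • gluingSolution u v`; its entries
are the values of the alternating form `L₁ ∧ L₂` on the spanning pairs, where `L₁`, `L₂` are the
additive maps with values `1, 0, u` and `0, 1, v` at `e₁, e₂, e₃`. -/
def gluingSolution {A : Type*} [CommRing A] (u v : A) : Fin 8 → A :=
  ![1, v, -u, v - u, 1 + v, 1 + u, 1 - v, 1 - u]

namespace GluingEquations

variable {A : Type*} [CommRing A] {u v w : A} {e : Fin 8 → A}

theorem map {B : Type*} [CommRing B] (f : A →+* B) (h : GluingEquations u v w e) :
    GluingEquations (f u) (f v) (f w) (f ∘ e) where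
  eq₁ := by simpa using congrArg f h.eq₁
  eq₂ := by simpa using congrArg f h.eq₂
  eq₃ := by simpa using congrArg f h.eq₃
  eq₄ := by simpa using congrArg f h.eq₄
  eq₅ := by simpa using congrArg f h.eq₅
  eq₆ := by simpa using congrArg f h.eq₆
  eq₇ := by simpa using congrArg f h.eq₇
  eq₈ := by simpa using congrArg f h.eq₈
  eq₉ := by simpa using congrArg f h.eq₉

theorem eq_of_mul_eq_zero (h : GluingEquations u v w e) (h3 : (3 : A) = 0)
    (hu₁ : IsUnit (u + v)) (hu₂ : IsUnit (1 + v - u)) (hu₃ : IsUnit (v - u - 1))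
    (hm : ∀ i j, e i * e j = 0) :
    w * e 0 = 0 ∧ ∀ i, e i = gluingSolution u v i * e 0 := by
  obtain ⟨B, hB⟩ : ∃ B, B = e 1 - v * e 0 := ⟨_, rfl⟩
  obtain ⟨C, hC⟩ : ∃ C, C = e 2 + u * e 0 := ⟨_, rfl⟩
  obtain ⟨X, hX⟩ : ∃ X, X = e 3 - (v - u) * e 0 := ⟨_, rfl⟩
  obtain ⟨Y, hY⟩ : ∃ Y, Y = e 4 - (1 + v) * e 0 := ⟨_, rfl⟩
  obtain ⟨Z, hZ⟩ : ∃ Z, Z = e 5 - (1 + u) * e 0 := ⟨_, rfl⟩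
  obtain ⟨Y', hY'⟩ : ∃ Y', Y' = e 6 - (1 - v) * e 0 := ⟨_, rfl⟩
  obtain ⟨Z', hZ'⟩ : ∃ Z', Z' = e 7 - (1 - u) * e 0 := ⟨_, rfl⟩
  -- the linearized equations for the deviation from the expected solution
  have l₁ : X * (1 - u) - Y * (1 - u) + u * C = 0 := by
    rw [hX, hY, hC]
    linear_combination h.eq₁ - hm 0 3 + u * hm 2 4
  have l₂ : X * (1 - v) + Y * (1 + v) - C * (1 - v) = 0 := by
    rw [hX, hY, hC]
    linear_combination h.eq₂ + hm 0 3 + (-1 + v) * hm 2 4 - e 0 * v * h3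
  have l₄ : X * (1 - u) - Z * (1 + u) - B * (1 - u) = 0 := by
    rw [hX, hZ, hB]
    linear_combination h.eq₄ - hm 0 3 + (1 - u) * hm 1 5 + e 0 * u * h3
  have l₅ : X * (1 - v) + Z * (1 - v) + v * B = 0 := by
    rw [hX, hZ, hB]
    linear_combination h.eq₅ + hm 0 3 - v * hm 1 5
  have l₆ : -X * (1 + u) - Y' * (1 + u) + u * C = 0 := by
    rw [hX, hY', hC]
    linear_combination h.eq₆ + hm 0 3 + u * hm 2 6
  have l₇ : -X * (1 + v) + Y' * (1 - v) + C * (1 + v) = 0 := by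
    rw [hX, hY', hC]
    linear_combination h.eq₇ - hm 0 3 + (1 + v) * hm 2 6 + e 0 * v * h3
  have l₈ : -X * (1 + u) - Z' * (1 - u) + B * (1 + u) = 0 := by
    rw [hX, hZ', hB]
    linear_combination h.eq₈ + hm 0 3 + (-1 - u) * hm 1 7 - e 0 * u * h3
  have l₉ : -X * (1 + v) + Z' * (1 + v) + v * B = 0 := by
    rw [hX, hZ', hB]
    linear_combination h.eq₉ - hm 0 3 - v * hm 1 7
  have x₁ : X * (1 - u) + (1 + u - v) * C = 0 := by
    linear_combination -(1 + v) * l₁ - (1 - u) * l₂ + (C * u + X - X * u) * h3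
  have x₂ : X * (1 + u) + (1 - u + v) * C = 0 := by
    linear_combination (1 - v) * l₆ + (1 + u) * l₇ + (X + X * u - C * u) * h3
  have xc : X + C = 0 := by linear_combination -x₁ - x₂ + (C + X) * h3
  have hC0 : C = 0 := (hu₁.mul_left_eq_zero).1
    (by linear_combination (1 - u) * xc - x₁ + C * u * h3)
  have hX0 : X = 0 := by linear_combination xc - hC0
  rw [hC0, hX0] at l₁ l₂ l₆ l₇
  rw [hX0] at l₄ l₅ l₈ l₉
  have hY0 : Y = 0 := (hu₃.mul_left_eq_zero).1 (by linear_combination -l₁ + l₂ - Y * h3)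
  have hY'0 : Y' = 0 := (hu₂.mul_left_eq_zero).1 (by linear_combination l₆ - l₇ + Y' * h3)
  have hB0 : B = 0 := (hu₂.mul_left_eq_zero).1
    (by linear_combination -(1 - v) * l₄ - (1 + u) * l₅ + B * v * h3)
  rw [hB0] at l₄ l₅ l₈ l₉
  have hZ0 : Z = 0 := (hu₂.mul_left_eq_zero).1 (by linear_combination l₄ - l₅ + Z * h3)
  have hZ'0 : Z' = 0 := (hu₃.mul_left_eq_zero).1 (by linear_combination -l₈ + l₉ - Z' * h3)
  rw [hB0] at hB
  rw [hC0] at hC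
  rw [hX0] at hX
  rw [hY0] at hY
  rw [hZ0] at hZ
  rw [hY'0] at hY'
  rw [hZ'0] at hZ'
  refine ⟨?_, fun i => ?_⟩
  · linear_combination h.eq₃ - w * hX + w * hY + w * hC + w * hm 2 4
  · fin_cases i
    · simp [gluingSolution]
    · simpa [gluingSolution] using (sub_eq_zero.1 hB.symm)
    · simp [gluingSolution]; linear_combination -hC
    · simpa [gluingSolution] using (sub_eq_zero.1 hX.symm)
    · simpa [gluingSolution] using (sub_eq_zero.1 hY.symm)
    · simpa [gluingSolution] using (sub_eq_zero.1 hZ.symm)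
    · simpa [gluingSolution] using (sub_eq_zero.1 hY'.symm)
    · simpa [gluingSolution] using (sub_eq_zero.1 hZ'.symm)

/-- The parameters generate a nilpotent ideal `N`.  The equations can be solved modulo `N²`, so
`N` is generated by `e 0` modulo `N²`, hence by Nakayama's lemma; then `N² = 0` because
`e 0 ^ 2 = 0`, and the solution is valid in `A`. -/
theorem eq_of_sq_eq_zero (h : GluingEquations u v w e) (h3 : (3 : A) = 0)
    (hu₁ : IsUnit (u + v)) (hu₂ : IsUnit (1 + v - u)) (hu₃ : IsUnit (v - u - 1))
    (hsq : ∀ i, e i ^ 2 = 0) :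
    w * e 0 = 0 ∧ ∀ i, e i = gluingSolution u v i * e 0 := by
  refine h.eq_of_mul_eq_zero h3 hu₁ hu₂ hu₃ ?_
  let N : Ideal A := Ideal.span (Set.range e)
  have hmem : ∀ i, e i ∈ N := fun i => Ideal.subset_span ⟨i, rfl⟩
  have hN : N ≤ Ideal.span {e 0} := by
    refine Submodule.le_of_le_smul_of_le_jacobson_bot (I := N)
      (Submodule.fg_span (Set.finite_range e)) ?_ ?_
    · refine le_trans ?_ (Ideal.radical_le_jacobson (I := ⊥))
      rw [Ideal.span_le]
      rintro _ ⟨i, rfl⟩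
      exact ⟨2, hsq i⟩
    · rw [Ideal.span_le]
      rintro _ ⟨i, rfl⟩
      let q := Ideal.Quotient.mk (N * N)
      have hq := (h.map q).eq_of_mul_eq_zero (by rw [← map_ofNat q 3, h3, map_zero])
        (by simpa using hu₁.map q) (by simpa using hu₂.map q) (by simpa using hu₃.map q)
        (fun i j => by
          rw [Function.comp_apply, Function.comp_apply, ← map_mul]
          exact Ideal.Quotient.eq_zero_iff_mem.2 (Ideal.mul_mem_mul (hmem i) (hmem j)))
      have hs : gluingSolution (q u) (q v) i = q (gluingSolution u v i) := by
        fin_cases i <;> simp [gluingSolution]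
      have hi := hq.2 i
      rw [hs, Function.comp_apply, Function.comp_apply, ← map_mul,
        Ideal.Quotient.mk_eq_mk_iff_sub_mem] at hi
      have := Submodule.add_mem_sup (Ideal.mul_mem_left _ (gluingSolution u v i)
        (Ideal.mem_span_singleton_self (e 0))) hi
      rwa [add_sub_cancel] at this
  intro i j
  obtain ⟨r, hr⟩ := Ideal.mem_span_singleton'.1 (hN (hmem i))
  obtain ⟨s, hs⟩ := Ideal.mem_span_singleton'.1 (hN (hmem j))
  rw [← hr, ← hs]
  linear_combination r * s * hsq 0

end GluingEquations

/-! ### Realizations of the truncated affine space -/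

/-- The family `p` of vectors, labelled by an abelian group `V` of exponent `3`, realizes the
matroid of rank `3` in which three distinct labels are dependent if and only if they form an affine
line over `𝔽₃`, i.e. add up to zero. -/
structure IsAffineRealization {V A : Type*} [AddCommGroup V] [CommRing A]
    (p : V → Fin 3 → A) : Prop where
  collinear : ∀ i j l, i ≠ j → j ≠ l → i ≠ l → i + j + l = 0 → det3 (p i) (p j) (p l) = 0
  noncollinear : ∀ i j l, i ≠ j → j ≠ l → i ≠ l → i + j + l ≠ 0 → IsUnit (det3 (p i) (p j) (p l))

namespace IsAffineRealization

variable {V A : Type*} [AddCommGroup V] [CommRing A] {p : V → Fin 3 → A}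

theorem smul (h : IsAffineRealization p) (c : V → Aˣ) :
    IsAffineRealization fun t => (c t : A) • p t where
  collinear i j l h₁ h₂ h₃ h₀ := by rw [det3_smul, h.collinear i j l h₁ h₂ h₃ h₀, mul_zero]
  noncollinear i j l h₁ h₂ h₃ h₀ := by
    rw [det3_smul]
    exact (((c i).isUnit.mul (c j).isUnit).mul (c l).isUnit).mul
      (h.noncollinear i j l h₁ h₂ h₃ h₀)

theorem mulVec (h : IsAffineRealization p) (g : GL (Fin 3) A) :
    IsAffineRealization fun t => (g : Matrix _ _ A).mulVec (p t) where
  collinear i j l h₁ h₂ h₃ h₀ := by rw [det3_mulVec, h.collinear i j l h₁ h₂ h₃ h₀, mul_zero]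
  noncollinear i j l h₁ h₂ h₃ h₀ := by
    rw [det3_mulVec]
    exact ((Matrix.isUnit_iff_isUnit_det _).1 g.isUnit).mul (h.noncollinear i j l h₁ h₂ h₃ h₀)

theorem comp {W : Type*} [AddCommGroup W] (h : IsAffineRealization p) (f : W →+ V)
    (hf : Function.Injective f) : IsAffineRealization (p ∘ f) where
  collinear i j l h₁ h₂ h₃ h₀ := h.collinear _ _ _ (hf.ne h₁) (hf.ne h₂) (hf.ne h₃)
    (by rw [← map_add, ← map_add, h₀, map_zero])
  noncollinear i j l h₁ h₂ h₃ h₀ := h.noncollinear _ _ _ (hf.ne h₁) (hf.ne h₂) (hf.ne h₃)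
    (by rw [← map_add, ← map_add]; exact fun h => h₀ (hf (h.trans (map_zero f).symm)))

end IsAffineRealization

/-- The affine space `AG(3, 3)`. -/
abbrev AffineSpace27 : Type := ZMod 3 × ZMod 3 × ZMod 3

namespace AffineSpace27

theorem add_add_self (t : AffineSpace27) : t + t + t = 0 := by
  revert t
  decide

theorem ne_neg_add : ∀ {s t : AffineSpace27}, s ≠ t → s ≠ -(s + t) ∧ t ≠ -(s + t) := by
  decide

theorem exists_noncollinear :
    ∀ {t : AffineSpace27}, t ≠ 0 → ∃ r, r ≠ 0 ∧ r ≠ t ∧ r ≠ -t ∧ t ≠ -t := by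
  decide

/-- One generator of each of the thirteen lines through the origin. -/
def directions : List AffineSpace27 :=
  [(1, 0, 0), (0, 1, 0), (0, 0, 1), (1, 1, 0), (1, -1, 0), (1, 0, 1), (1, 0, -1), (0, 1, 1),
    (0, 1, -1), (1, 1, 1), (1, 1, -1), (1, -1, -1), (1, -1, 1)]

theorem eq_zero_or_mem_directions :
    ∀ t : AffineSpace27, t = 0 ∨ t ∈ directions ∨ -t ∈ directions := by
  decide

end AffineSpace27

namespace IsAffineRealization

variable {A : Type*} [CommRing A] {p : AffineSpace27 → Fin 3 → A}

theorem det3_eq_zero (hp : IsAffineRealization p) {i j l : AffineSpace27} (hij : i ≠ j)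
    (h : i + j + l = 0) : det3 (p i) (p j) (p l) = 0 := by
  obtain rfl : l = -(i + j) := (neg_eq_of_add_eq_zero_right h).symm
  have := AffineSpace27.ne_neg_add hij
  exact hp.collinear _ _ _ hij this.2 this.1 h

theorem isUnit_det3_zero (hp : IsAffineRealization p) {s t : AffineSpace27} (hs : s ≠ 0)
    (ht : t ≠ 0) (hst : s ≠ t) (hst' : s ≠ -t) : IsUnit (det3 (p 0) (p s) (p t)) :=
  hp.noncollinear _ _ _ hs.symm hst ht.symm fun h =>
    hst' (eq_neg_of_add_eq_zero_left (by rwa [zero_add] at h))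

/-! ### Normalization by scaling and by a projective transformation -/

/-- The vectors can be scaled so that they add up to zero on every line through the origin. -/
theorem exists_smul_add_smul_add_eq_zero (hp : IsAffineRealization p) (h3 : (3 : A) = 0) :
    ∃ c : AffineSpace27 → Aˣ,
      ∀ t, (c t : A) • p t + (c (-t) : A) • p (-t) + (c 0 : A) • p 0 = 0 := by
  have key : ∀ t, t ≠ 0 → ∃ x : Aˣ × Aˣ, (x.1 : A) • p t + (x.2 : A) • p (-t) + p 0 = 0 := by
    intro t ht
    obtain ⟨r, hr0, hrt, hrt', htt⟩ := AffineSpace27.exists_noncollinear ht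
    have hu := hp.isUnit_det3_zero ht hr0 hrt.symm fun h => hrt' (by rw [h, neg_neg])
    obtain ⟨x, y, z, h⟩ := exists_eq_of_isUnit_det3 hu (p (-t))
    have hz : z = 0 := by
      refine (hu.mul_left_eq_zero).1 ?_
      rw [← hp.det3_eq_zero (i := 0) (j := t) (l := -t) ht.symm (by simp), h]
      simp [det3_apply]
      ring
    have hy : IsUnit y := by
      have := hp.isUnit_det3_zero (neg_ne_zero.2 ht) hr0 hrt'.symm
        fun h => hrt (neg_injective h.symm)
      have he : det3 (p 0) (p (-t)) (p r) = y * det3 (p 0) (p t) (p r) := by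
        rw [h, hz]
        simp [det3_apply]
        ring
      rw [he] at this
      exact isUnit_of_mul_isUnit_left this
    have hx : IsUnit x := by
      have := hp.noncollinear (-t) t r htt.symm hrt.symm hrt'.symm (by simpa using hr0)
      have he : det3 (p (-t)) (p t) (p r) = x * det3 (p 0) (p t) (p r) := by
        rw [h, hz]
        simp [det3_apply]
        ring
      rw [he] at this
      exact isUnit_of_mul_isUnit_left this
    obtain ⟨x, rfl⟩ := hx
    obtain ⟨y, rfl⟩ := hy
    refine ⟨(x⁻¹ * y, -x⁻¹), ?_⟩
    rw [h, hz]
    simp only [Units.val_mul, Units.val_neg, smul_add, smul_smul, neg_mul, Units.inv_mul]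
    module
  choose! x hx using key
  have huniq : ∀ t, t ≠ 0 → (x (-t)).1 = (x t).2 := by
    intro t ht
    obtain ⟨r, hr0, hrt, hrt', htt⟩ := AffineSpace27.exists_noncollinear ht
    have hu := hp.noncollinear (-t) t r htt.symm hrt.symm hrt'.symm (by simpa using hr0)
    have h1 := hx t ht
    have h2 := hx (-t) (neg_ne_zero.2 ht)
    rw [neg_neg] at h2
    have h : ((x (-t)).1 - (x t).2 : A) • p (-t) = ((x t).1 - (x (-t)).2 : A) • p t := by
      have h12 := h2.trans h1.symm
      rw [← sub_eq_zero] at h12 ⊢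
      rw [← h12]
      module
    have h0 : ((x (-t)).1 - (x t).2 : A) * det3 (p (-t)) (p t) (p r) = 0 := by
      have : det3 (((x (-t)).1 - (x t).2 : A) • p (-t)) (p t) (p r) = 0 := by
        rw [h]
        simp [det3_apply]
        ring
      rw [← this]
      simp [det3_apply]
      ring
    exact Units.ext (sub_eq_zero.1 ((hu.mul_left_eq_zero).1 h0))
  classical
  refine ⟨fun t => if t = 0 then 1 else (x t).1, fun t => ?_⟩
  by_cases ht : t = 0
  · subst ht
    simp only [neg_zero, if_true, Units.val_one, one_smul]
    have : (3 : A) • p 0 = 0 := by rw [h3, zero_smul]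
    rw [← this]
    module
  · simp only [ht, neg_eq_zero, if_false, if_true, huniq t ht, Units.val_one, one_smul]
    exact hx t ht

/-- A projective transformation moves the origin and the first two unit vectors of `AG(3, 3)` to
the points with the same coordinates in the affine chart of the plane. -/
theorem exists_mulVec_eq (hp : IsAffineRealization p) :
    ∃ g : GL (Fin 3) A, (g : Matrix _ _ A).mulVec (p 0) = ![0, 0, 1] ∧
      (g : Matrix _ _ A).mulVec (p (1, 0, 0)) = ![1, 0, 1] ∧
      (g : Matrix _ _ A).mulVec (p (0, 1, 0)) = ![0, 1, 1] := by
  let B : Matrix (Fin 3) (Fin 3) A :=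
    (Matrix.of ![p (1, 0, 0) - p 0, p (0, 1, 0) - p 0, p 0]).transpose
  have hB : IsUnit B := by
    rw [Matrix.isUnit_iff_isUnit_det, Matrix.det_transpose]
    have : det3 (p (1, 0, 0) - p 0) (p (0, 1, 0) - p 0) (p 0) =
        det3 (p 0) (p (1, 0, 0)) (p (0, 1, 0)) := by
      simp only [det3_apply, Pi.sub_apply]
      ring
    rw [← det3, this]
    exact hp.isUnit_det3_zero (by decide) (by decide) (by decide) (by decide)
  obtain ⟨b, hb⟩ := hB
  have h0 : p 0 = B.mulVec ![0, 0, 1] := by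
    ext i; simp [B, Matrix.mulVec, dotProduct, Fin.sum_univ_three]
  have h1 : p (1, 0, 0) = B.mulVec ![1, 0, 1] := by
    ext i; simp [B, Matrix.mulVec, dotProduct, Fin.sum_univ_three]
  have h2 : p (0, 1, 0) = B.mulVec ![0, 1, 1] := by
    ext i; simp [B, Matrix.mulVec, dotProduct, Fin.sum_univ_three]
  refine ⟨b⁻¹, ?_⟩
  have : ((b⁻¹ : GL (Fin 3) A) : Matrix _ _ A) * B = 1 := by rw [← hb]; exact b.inv_mul
  simp only [h0, h1, h2, Matrix.mulVec_mulVec, this, Matrix.one_mulVec, and_self]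

end IsAffineRealization

/-! ### The normal form of a realization -/

/-- The additive map `AG(3, 3) → A` with values `1, 0, u` at the unit vectors. -/
def firstCoord {A : Type*} [CommRing A] (κ : ZMod 3 →+* A) (u : A) : AffineSpace27 →+ A where
  toFun t := κ t.1 + κ t.2.2 * u
  map_zero' := by simp
  map_add' s t := by simp; ring

/-- The additive map `AG(3, 3) → A` with values `0, 1, v` at the unit vectors. -/
def secondCoord {A : Type*} [CommRing A] (κ : ZMod 3 →+* A) (v : A) : AffineSpace27 →+ A where
  toFun t := κ t.2.1 + κ t.2.2 * v
  map_zero' := by simp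
  map_add' s t := by simp; ring

/-- The additive map `AG(3, 3) → A` with values `0, 0, w` at the unit vectors. -/
def thirdCoord {A : Type*} [CommRing A] (κ : ZMod 3 →+* A) (w : A) : AffineSpace27 →+ A where
  toFun t := κ t.2.2 * w
  map_zero' := by simp
  map_add' s t := by simp; ring

/-- The normal form of a realization of the truncation of `AG(3, 3)` in characteristic `3`.  For
`ε = 0` it is the projection of `AG(3, 3) ⊆ PG(3, 3)` from a point.  For `w = 0` it deforms a
linear map `(L₁, L₂)` along the vector field `L₁² L₂ ∂₁ - L₁ L₂² ∂₂`. -/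
def normalForm {A : Type*} [CommRing A] (κ : ZMod 3 →+* A) (u v w ε : A) (t : AffineSpace27) :
    Fin 3 → A :=
  ![firstCoord κ u t + ε * (firstCoord κ u t ^ 2 * secondCoord κ v t),
    secondCoord κ v t - ε * (firstCoord κ u t * secondCoord κ v t ^ 2),
    1 + thirdCoord κ w t]

section NormalForm

variable {A : Type*} [CommRing A] {κ : ZMod 3 →+* A} {u v w ε : A}

theorem three_eq_zero_of_ringHom (κ : ZMod 3 →+* A) : (3 : A) = 0 := by
  rw [← map_ofNat κ 3]
  exact map_zero κ

theorem mul_thirdCoord (hw : ε * w = 0) (t : AffineSpace27) : ε * thirdCoord κ w t = 0 := by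
  simp only [thirdCoord, AddMonoidHom.coe_mk, ZeroHom.coe_mk]
  linear_combination κ t.2.2 * hw

/-- The alternating form `L₁ ∧ L₂`, which gives the parameter of the plane spanned by `s`, `t`. -/
def wedge (κ : ZMod 3 →+* A) (u v : A) (s t : AffineSpace27) : A :=
  firstCoord κ u s * secondCoord κ v t - secondCoord κ v s * firstCoord κ u t

theorem normalForm_zero : normalForm κ u v w ε 0 = ![0, 0, 1] := by
  simp [normalForm]

theorem normalForm_e₁ : normalForm κ u v w ε (1, 0, 0) = ![1, 0, 1] := by
  simp [normalForm, firstCoord, secondCoord, thirdCoord]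

theorem normalForm_e₂ : normalForm κ u v w ε (0, 1, 0) = ![0, 1, 1] := by
  simp [normalForm, firstCoord, secondCoord, thirdCoord]

theorem normalForm_neg (t : AffineSpace27) :
    normalForm κ u v w ε t + normalForm κ u v w ε (-t) + normalForm κ u v w ε 0 = 0 := by
  have h3 := three_eq_zero_of_ringHom κ
  rw [normalForm_zero]
  ext i
  fin_cases i
  · simp [normalForm]
    ring
  · simp [normalForm]
  · simp [normalForm]
    linear_combination h3

theorem normalForm_add (h2 : ε ^ 2 = 0) (hw : ε * w = 0) (s t : AffineSpace27) :
    normalForm κ u v w ε (s + t) - ![0, 0, 1] =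
      (1 + ε * wedge κ u v s t) • (normalForm κ u v w ε s - ![0, 0, 1]) +
        (1 - ε * wedge κ u v s t) • (normalForm κ u v w ε t - ![0, 0, 1]) := by
  have h3 := three_eq_zero_of_ringHom κ
  have hs := mul_thirdCoord (κ := κ) hw s
  have ht := mul_thirdCoord (κ := κ) hw t
  ext i
  fin_cases i <;> simp [normalForm, wedge] <;> grind

theorem normalForm_sub (h2 : ε ^ 2 = 0) (hw : ε * w = 0) (s t : AffineSpace27) :
    normalForm κ u v w ε (s - t) - ![0, 0, 1] =
      (1 - ε * wedge κ u v s t) • (normalForm κ u v w ε s - ![0, 0, 1]) -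
        (1 + ε * wedge κ u v s t) • (normalForm κ u v w ε t - ![0, 0, 1]) := by
  have h3 := three_eq_zero_of_ringHom κ
  have hs := mul_thirdCoord (κ := κ) hw s
  have ht := mul_thirdCoord (κ := κ) hw t
  ext i
  fin_cases i <;> simp [normalForm, wedge] <;> grind

theorem det3_normalForm_eq_zero (h2 : ε ^ 2 = 0) (hw : ε * w = 0) {i j l : AffineSpace27}
    (h : i + j + l = 0) :
    det3 (normalForm κ u v w ε i) (normalForm κ u v w ε j) (normalForm κ u v w ε l) = 0 := by
  have h3 := three_eq_zero_of_ringHom κ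
  have hi := mul_thirdCoord (κ := κ) hw i
  have hj := mul_thirdCoord (κ := κ) hw j
  obtain rfl : l = -(i + j) := (neg_eq_of_add_eq_zero_right h).symm
  rw [det3_apply]
  simp [normalForm]
  grind

/-- The parameters of a normal form are determined by the realization up to projective
transformations. -/
theorem normalForm_unique {u' v' w' ε' : A}
    (hp : IsAffineRealization (normalForm κ u v w ε)) (h2 : ε ^ 2 = 0) (h2' : ε' ^ 2 = 0)
    (h : ∃ (g : GL (Fin 3) A) (c : AffineSpace27 → Aˣ), ∀ t, normalForm κ u' v' w' ε' t =
      (c t : A) • (g : Matrix _ _ A).mulVec (normalForm κ u v w ε t)) :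
    u = u' ∧ v = v' ∧ w = w' ∧ ε = ε' := by
  have h3 := three_eq_zero_of_ringHom κ
  obtain ⟨g, c, h⟩ := h
  let q t := (g : Matrix (Fin 3) (Fin 3) A).mulVec (normalForm κ u v w ε t)
  have hq : IsAffineRealization q := hp.mulVec g
  -- the vectors on a line through the origin add up to zero on both sides, so they are rescaled
  -- by the same unit
  have hc : ∀ t, c t = c 0 := by
    intro t
    by_cases ht : t = 0
    · rw [ht]
    obtain ⟨r, hr0, hrt, hrt', htt⟩ := AffineSpace27.exists_noncollinear ht
    have hu := hq.noncollinear t (-t) r htt hrt'.symm hrt.symm (by simpa using hr0)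
    have h1 : (c t : A) • q t + (c (-t) : A) • q (-t) + (c 0 : A) • q 0 = 0 := by
      rw [← h, ← h, ← h, normalForm_neg]
    have h2 : q t + q (-t) + q 0 = 0 := by
      simp only [q]
      rw [← Matrix.mulVec_add, ← Matrix.mulVec_add, normalForm_neg, Matrix.mulVec_zero]
    have h4 : (c t - c 0 : A) • q t = (c 0 - c (-t) : A) • q (-t) := by
      have h12 : (c t : A) • q t + (c (-t) : A) • q (-t) + (c 0 : A) • q 0 -
        (c 0 : A) • (q t + q (-t) + q 0) = 0 := by rw [h1, h2, smul_zero, sub_zero]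
      rw [← sub_eq_zero, ← h12]
      module
    have h5 : (c t - c 0 : A) * det3 (q t) (q (-t)) (q r) = 0 := by
      have : det3 ((c t - c 0 : A) • q t) (q (-t)) (q r) = 0 := by
        rw [h4]
        simp [det3_apply]
        ring
      rw [← this]
      simp [det3_apply]
      ring
    exact Units.ext (sub_eq_zero.1 ((hu.mul_left_eq_zero).1 h5))
  have h' : ∀ t, normalForm κ u' v' w' ε' t =
      ((c 0 : A) • (g : Matrix (Fin 3) (Fin 3) A)).mulVec (normalForm κ u v w ε t) := fun t => by
    rw [h, hc, Matrix.smul_mulVec]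
  have h1 : (c 0 : A) • (g : Matrix (Fin 3) (Fin 3) A) = 1 := by
    have k0 := h' 0
    have k1 := h' (1, 0, 0)
    have k2 := h' (0, 1, 0)
    rw [normalForm_zero, normalForm_zero] at k0
    rw [normalForm_e₁, normalForm_e₁] at k1
    rw [normalForm_e₂, normalForm_e₂] at k2
    ext i j
    have k0 := congrFun k0 i
    have k1 := congrFun k1 i
    have k2 := congrFun k2 i
    simp only [Matrix.mulVec, dotProduct, Fin.sum_univ_three, Matrix.cons_val_zero,
      Matrix.cons_val_one, Matrix.cons_val, mul_zero, mul_one, zero_add, add_zero] at k0 k1 k2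
    rw [← k0] at k1 k2
    fin_cases j
    · exact (eq_sub_of_add_eq k1.symm).trans (by fin_cases i <;> simp)
    · exact (eq_sub_of_add_eq k2.symm).trans (by fin_cases i <;> simp)
    · exact k0.symm.trans (by fin_cases i <;> simp)
  simp only [h1, Matrix.one_mulVec] at h'
  have hε : ε = ε' := by
    have := congrFun (h' (1, 1, 0)) 0
    simp [normalForm, firstCoord, secondCoord] at this
    exact this.symm
  subst hε
  have a1 := congrFun (h' (0, 0, 1)) 0
  have a2 := congrFun (h' (0, 0, 1)) 1
  have a3 := congrFun (h' (0, 0, 1)) 2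
  simp [normalForm, firstCoord, secondCoord, thirdCoord] at a1 a2 a3
  have b1 : ε * u' = ε * u := by linear_combination ε * a1 + (u ^ 2 * v - u' ^ 2 * v') * h2
  have b2 : ε * v' = ε * v := by linear_combination ε * a2 - (u * v ^ 2 - u' * v' ^ 2) * h2
  refine ⟨?_, ?_, a3.symm, rfl⟩
  · grind
  · grind

end NormalForm

/-! ### Every realization has a normal form -/

namespace IsAffineRealization

variable {A : Type*} [CommRing A] {p : AffineSpace27 → Fin 3 → A}

theorem exists_parameter (hp : IsAffineRealization p) (h3 : (3 : A) = 0)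
    (hsum : ∀ t, p t + p (-t) + p 0 = 0) {s t a b : AffineSpace27} (hab : s + t = a ∧ s - t = b)
    (hst : s ≠ 0 ∧ t ≠ 0 ∧ s ≠ t ∧ s ≠ -t) :
    ∃ ε : A, ε ^ 2 = 0 ∧ p a - p 0 = (1 + ε) • (p s - p 0) + (1 - ε) • (p t - p 0) ∧
      p b - p 0 = (1 - ε) • (p s - p 0) - (1 + ε) • (p t - p 0) := by
  obtain ⟨rfl, rfl⟩ := hab
  obtain ⟨hs, ht, hst, hst'⟩ := hst
  have hpos : ∀ r, p 0 + (p r - p 0) = p r := fun r => by abel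
  have hneg : ∀ r, p 0 - (p r - p 0) = p (-r) := fun r => by
    have h0 : (3 : A) • p 0 = 0 := by rw [h3, zero_smul]
    have : p 0 - (p r - p 0) - p (-r) = (3 : A) • p 0 - (p r + p (-r) + p 0) := by module
    rw [← sub_eq_zero, this, h0, hsum, sub_zero]
  have hself := AffineSpace27.add_add_self
  apply exists_sq_zero_of_affinePlane h3
  · have : det3 (p 0) (p s - p 0) (p t - p 0) = det3 (p 0) (p s) (p t) := by
      simp only [det3_apply, Pi.sub_apply]
      ring
    rw [this]
    exact hp.isUnit_det3_zero hs ht hst hst'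
  · rw [hpos, hpos, hneg]
    exact hp.det3_eq_zero hst (by abel)
  · rw [hneg, hneg, hpos]
    exact hp.det3_eq_zero (neg_injective.ne hst) (by abel)
  · rw [hpos, hneg, hneg]
    exact hp.det3_eq_zero hst' (by abel)
  · rw [hneg, hpos, hpos]
    exact hp.det3_eq_zero (fun h => hst' (by rw [← h, neg_neg])) (by abel)
  · rw [hpos, hpos, hpos]
    exact hp.det3_eq_zero (by simpa using ht) (by rw [← hself s]; abel)
  · rw [hpos, hpos, hneg]
    exact hp.det3_eq_zero (by simpa using hs) (by rw [← hself t]; abel)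

theorem isUnit_of_isUnit_sub {a x y r s : A} (h : IsUnit a) (hx : x ^ 2 = 0) (hy : y ^ 2 = 0)
    {b : A} (hab : a = b + (r * x + s * y)) : IsUnit b := by
  have hn : IsNilpotent (r * x + s * y) := by
    refine (Commute.all _ _).isNilpotent_add ⟨2, ?_⟩ ⟨2, ?_⟩
    · rw [mul_pow, hx, mul_zero]
    · rw [mul_pow, hy, mul_zero]
  rw [← sub_eq_of_eq_add hab, sub_eq_add_neg]
  exact hn.neg.isUnit_add_left_of_commute h (Commute.all _ _)

/-- A realization for which the scalings and the projective transformation are normalized is a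
normal form. -/
theorem eq_normalForm (hp : IsAffineRealization p) (κ : ZMod 3 →+* A)
    (hsum : ∀ t, p t + p (-t) + p 0 = 0) (h0 : p 0 = ![0, 0, 1]) (h1 : p (1, 0, 0) = ![1, 0, 1])
    (h2 : p (0, 1, 0) = ![0, 1, 1]) :
    ∃ u v w ε : A, ε ^ 2 = 0 ∧ ε * w = 0 ∧ p = normalForm κ u v w ε := by
  have h3 := three_eq_zero_of_ringHom κ
  obtain ⟨e₀, q₀, k₀, k₀'⟩ := hp.exists_parameter h3 hsum (s := (1, 0, 0)) (t := (0, 1, 0))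
    (a := (1, 1, 0)) (b := (1, -1, 0)) (by decide) (by decide)
  obtain ⟨e₁, q₁, k₁, k₁'⟩ := hp.exists_parameter h3 hsum (s := (1, 0, 0)) (t := (0, 0, 1))
    (a := (1, 0, 1)) (b := (1, 0, -1)) (by decide) (by decide)
  obtain ⟨e₂, q₂, k₂, k₂'⟩ := hp.exists_parameter h3 hsum (s := (0, 1, 0)) (t := (0, 0, 1))
    (a := (0, 1, 1)) (b := (0, 1, -1)) (by decide) (by decide)
  obtain ⟨e₃, q₃, k₃, k₃'⟩ := hp.exists_parameter h3 hsum (s := (1, 1, 0)) (t := (0, 0, 1))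
    (a := (1, 1, 1)) (b := (1, 1, -1)) (by decide) (by decide)
  obtain ⟨e₄, q₄, k₄, k₄'⟩ := hp.exists_parameter h3 hsum (s := (1, 0, 0)) (t := (0, 1, 1))
    (a := (1, 1, 1)) (b := (1, -1, -1)) (by decide) (by decide)
  obtain ⟨e₅, q₅, k₅, k₅'⟩ := hp.exists_parameter h3 hsum (s := (1, 0, 1)) (t := (0, 1, 0))
    (a := (1, 1, 1)) (b := (1, -1, 1)) (by decide) (by decide)
  obtain ⟨e₆, q₆, k₆, k₆'⟩ := hp.exists_parameter h3 hsum (s := (1, 0, 0)) (t := (0, 1, -1))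
    (a := (1, 1, -1)) (b := (1, -1, 1)) (by decide) (by decide)
  obtain ⟨e₇, q₇, k₇, k₇'⟩ := hp.exists_parameter h3 hsum (s := (1, 0, -1)) (t := (0, 1, 0))
    (a := (1, 1, -1)) (b := (1, -1, -1)) (by decide) (by decide)
  have hD₁ : p (1, 0, 0) - p 0 = ![1, 0, 0] := by
    rw [h1, h0]
    ext i
    fin_cases i <;> simp
  have hD₂ : p (0, 1, 0) - p 0 = ![0, 1, 0] := by
    rw [h2, h0]
    ext i
    fin_cases i <;> simp
  obtain ⟨U, V, W, hD₃⟩ : ∃ U V W, p (0, 0, 1) - p 0 = ![U, V, W] :=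
    ⟨_, _, _, by ext i; fin_cases i <;> rfl⟩
  have hglue : GluingEquations U V W ![e₀, e₁, e₂, e₃, e₄, e₅, e₆, e₇] := by
    have g₁ := k₃.symm.trans k₄
    have g₂ := k₃.symm.trans k₅
    have g₃ := k₃'.symm.trans k₆
    have g₄ := k₃'.symm.trans k₇
    rw [k₀, k₂, hD₁, hD₂, hD₃] at g₁
    rw [k₀, k₁, hD₁, hD₂, hD₃] at g₂
    rw [k₀, k₂', hD₁, hD₂, hD₃] at g₃
    rw [k₀, k₁', hD₁, hD₂, hD₃] at g₄
    constructor
    · have := congrFun g₁ 0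
      simp at this ⊢
      linear_combination this
    · have := congrFun g₁ 1
      simp at this ⊢
      linear_combination this
    · have := congrFun g₁ 2
      simp at this ⊢
      linear_combination this
    · have := congrFun g₂ 0
      simp at this ⊢
      linear_combination this
    · have := congrFun g₂ 1
      simp at this ⊢
      linear_combination this
    · have := congrFun g₃ 0
      simp at this ⊢
      linear_combination this
    · have := congrFun g₃ 1
      simp at this ⊢
      linear_combination this
    · have := congrFun g₄ 0
      simp at this ⊢
      linear_combination this
    · have := congrFun g₄ 1
      simp at this ⊢
      linear_combination this
  have hdet : ∀ s t, det3 (p 0) (p s) (p t) =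
      (p s - p 0) 0 * (p t - p 0) 1 - (p s - p 0) 1 * (p t - p 0) 0 := by
    intro s t
    rw [h0]
    simp [det3_apply]
  have hu₁ : IsUnit (U + V) := by
    have := hp.isUnit_det3_zero (s := (1, -1, 0)) (t := (0, 0, 1)) (by decide) (by decide)
      (by decide) (by decide)
    refine isUnit_of_isUnit_sub this q₀ q₀ (r := U - V) (s := 0) ?_
    rw [hdet, k₀', hD₁, hD₂, hD₃]
    simp
    ring
  have hu₂ : IsUnit (1 + V - U) := by
    have := hp.isUnit_det3_zero (s := (1, 1, 0)) (t := (1, 0, -1)) (by decide) (by decide)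
      (by decide) (by decide)
    rw [← IsUnit.neg_iff]
    refine isUnit_of_isUnit_sub this q₀ q₁ (r := (-(1 + e₁) * V + (1 - e₁ - (1 + e₁) * U)))
      (s := -V + 1 + U) ?_
    rw [hdet, k₀, k₁', hD₁, hD₂, hD₃]
    simp
    ring
  have hu₃ : IsUnit (V - U - 1) := by
    have := hp.isUnit_det3_zero (s := (1, 1, 0)) (t := (1, 0, 1)) (by decide) (by decide)
      (by decide) (by decide)
    refine isUnit_of_isUnit_sub this q₀ q₁ (r := ((1 - e₁) * V + (1 + e₁ + (1 - e₁) * U)))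
      (s := -V - 1 + U) ?_
    rw [hdet, k₀, k₁, hD₁, hD₂, hD₃]
    simp
    ring
  obtain ⟨hw, hsol⟩ := hglue.eq_of_sq_eq_zero h3 hu₁ hu₂ hu₃ (fun i => by
    fin_cases i <;> assumption)
  have s₁ := hsol 1
  have s₂ := hsol 2
  have s₃ := hsol 3
  have s₄ := hsol 4
  have s₅ := hsol 5
  have s₆ := hsol 6
  have s₇ := hsol 7
  simp [gluingSolution] at hw s₁ s₂ s₃ s₄ s₅ s₆ s₇
  have hw' : e₀ * W = 0 := by rw [mul_comm, hw]
  refine ⟨U - e₀ * (U ^ 2 * V), V + e₀ * (U * V ^ 2), W, e₀, q₀, hw', ?_⟩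
  let n := normalForm κ (U - e₀ * (U ^ 2 * V)) (V + e₀ * (U * V ^ 2)) W e₀
  change p = n
  have n0 : n 0 = p 0 := by rw [h0, ← normalForm_zero]
  have n1 : p (1, 0, 0) = n (1, 0, 0) := by rw [h1, ← normalForm_e₁]
  have n2 : p (0, 1, 0) = n (0, 1, 0) := by rw [h2, ← normalForm_e₂]
  have n3 : p (0, 0, 1) = n (0, 0, 1) := by
    rw [sub_eq_iff_eq_add.1 hD₃, h0]
    ext i
    fin_cases i <;> simp [n, normalForm, firstCoord, secondCoord, thirdCoord] <;> grind
  -- the normal form satisfies the same relations as `p` in each of the planes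
  have step : ∀ {s t a b : AffineSpace27} {e : A}, s + t = a ∧ s - t = b →
      p a - p 0 = (1 + e) • (p s - p 0) + (1 - e) • (p t - p 0) →
      p b - p 0 = (1 - e) • (p s - p 0) - (1 + e) • (p t - p 0) →
      e = e₀ * wedge κ (U - e₀ * (U ^ 2 * V)) (V + e₀ * (U * V ^ 2)) s t →
      p s = n s → p t = n t → p a = n a ∧ p b = n b := by
    rintro s t _ _ e ⟨rfl, rfl⟩ ka kb he hs ht
    rw [hs, ht, he, h0] at ka kb
    exact ⟨sub_left_injective (ka.trans (normalForm_add q₀ hw' s t).symm),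
      sub_left_injective (kb.trans (normalForm_sub q₀ hw' s t).symm)⟩
  obtain ⟨n4, n5⟩ := step (by decide) k₀ k₀' (by simp [wedge, firstCoord, secondCoord]) n1 n2
  obtain ⟨n6, n7⟩ := step (by decide) k₁ k₁'
    (by simp [wedge, firstCoord, secondCoord]; grind) n1 n3
  obtain ⟨n8, n9⟩ := step (by decide) k₂ k₂'
    (by simp [wedge, firstCoord, secondCoord]; grind) n2 n3
  obtain ⟨n10, n11⟩ := step (by decide) k₃ k₃'
    (by simp [wedge, firstCoord, secondCoord]; grind) n4 n3
  obtain ⟨-, n12⟩ := step (by decide) k₄ k₄'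
    (by simp [wedge, firstCoord, secondCoord]; grind) n1 n8
  obtain ⟨-, n13⟩ := step (by decide) k₅ k₅'
    (by simp [wedge, firstCoord, secondCoord]; grind) n6 n2
  have hneg : ∀ t, p (-t) = n (-t) → p t = n t := by
    intro t ht
    have := (hsum t).trans (normalForm_neg (κ := κ) (u := U - e₀ * (U ^ 2 * V))
      (v := V + e₀ * (U * V ^ 2)) (w := W) (ε := e₀) t).symm
    change p t + p (-t) + p 0 = n t + n (-t) + n 0 at this
    rw [n0, ht] at this
    exact add_right_cancel (add_right_cancel this)
  have hall : ∀ t ∈ AffineSpace27.directions, p t = n t := by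
    simp only [AffineSpace27.directions, List.forall_mem_cons]
    exact ⟨n1, n2, n3, n4, n5, n6, n7, n8, n9, n10, n11, n12, n13, by simp⟩
  funext t
  rcases AffineSpace27.eq_zero_or_mem_directions t with rfl | ht | ht
  · exact n0.symm
  · exact hall t ht
  · exact hneg t (hall _ ht)

/-- Every realization is projectively equivalent to a normal form. -/
theorem exists_normalForm (hp : IsAffineRealization p) (κ : ZMod 3 →+* A) :
    ∃ u v w ε : A, ε ^ 2 = 0 ∧ ε * w = 0 ∧ ∃ (g : GL (Fin 3) A) (c : AffineSpace27 → Aˣ),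
      ∀ t, normalForm κ u v w ε t = (c t : A) • (g : Matrix _ _ A).mulVec (p t) := by
  obtain ⟨c, hc⟩ := hp.exists_smul_add_smul_add_eq_zero (three_eq_zero_of_ringHom κ)
  obtain ⟨g, hg⟩ := (hp.smul c).exists_mulVec_eq
  obtain ⟨u, v, w, ε, h2, hw, h⟩ := ((hp.smul c).mulVec g).eq_normalForm κ
    (fun t => by rw [← Matrix.mulVec_add, ← Matrix.mulVec_add, hc, Matrix.mulVec_zero])
    hg.1 hg.2.1 hg.2.2
  exact ⟨u, v, w, ε, h2, hw, g, c, fun t =>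
    (congrFun h t).symm.trans (Matrix.mulVec_smul _ _ _)⟩

end IsAffineRealization

/-! ### Parallel lines in characteristic different from three -/

namespace AffineSpace27

set_option synthInstance.maxSize 1000 in
/-- The hypothesis says that `d` and `q` are linearly independent.  Then in the plane spanned by `d`
and `q` no point outside the line `⟨d⟩` is collinear with two points of it. -/
theorem noncollinear_of_mem : ∀ {d q : AffineSpace27}, d ≠ 0 ∧ q ≠ 0 ∧ q ≠ d ∧ q ≠ -d →
    ∀ r ∈ [q, q + d, q - d, -q, d - q], 0 ≠ d ∧ d ≠ r ∧ 0 ≠ r ∧ 0 + d + r ≠ 0 := by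
  decide

set_option synthInstance.maxSize 1000 in
theorem noncollinear_of_mem' : ∀ {d q : AffineSpace27}, d ≠ 0 ∧ q ≠ 0 ∧ q ≠ d ∧ q ≠ -d →
    ∀ r ∈ [0, d], q ≠ q + d ∧ q + d ≠ r ∧ q ≠ r ∧ q + (q + d) + r ≠ 0 := by
  decide

set_option synthInstance.maxSize 1000 in
theorem ne_of_independent : ∀ {d q : AffineSpace27}, d ≠ 0 ∧ q ≠ 0 ∧ q ≠ d ∧ q ≠ -d →
    d ≠ q - d ∧ -d ≠ q + d ∧ 0 ≠ q - d ∧ d ≠ q + d ∧ -d ≠ q := by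
  decide

end AffineSpace27

namespace IsAffineRealization

variable {K : Type*} [Field K] {p : AffineSpace27 → Fin 3 → K} {d q : AffineSpace27}

/-- The parameter of the intersection point of the line `q + ⟨d⟩` with the line `⟨d⟩`: the point is
`slope p d q • p 0 + p d`. -/
def slope (p : AffineSpace27 → Fin 3 → K) (d q : AffineSpace27) : K :=
  -det3 (p q) (p (q + d)) (p d) / det3 (p q) (p (q + d)) (p 0)

theorem slope_mulVec (g : GL (Fin 3) K) :
    slope (fun t => (g : Matrix _ _ K).mulVec (p t)) d q = slope p d q := by
  have : (g : Matrix (Fin 3) (Fin 3) K).det ≠ 0 :=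
    ((Matrix.isUnit_iff_isUnit_det _).1 g.isUnit).ne_zero
  simp only [slope, det3_mulVec]
  rw [neg_div, neg_div, mul_div_mul_left _ _ this]

theorem det3_eq_zero_iff_slope (hp : IsAffineRealization p)
    (h : d ≠ 0 ∧ q ≠ 0 ∧ q ≠ d ∧ q ≠ -d) {x y : K} :
    det3 (p q) (p (q + d)) (x • p 0 + y • p d) = 0 ↔ x = slope p d q * y := by
  obtain ⟨h₁, h₂, h₃, h₄⟩ := AffineSpace27.noncollinear_of_mem' h 0 (by simp)
  have hu := (hp.noncollinear _ _ _ h₁ h₂ h₃ h₄).ne_zero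
  have : det3 (p q) (p (q + d)) (x • p 0 + y • p d) =
      x * det3 (p q) (p (q + d)) (p 0) + y * det3 (p q) (p (q + d)) (p d) := by
    simp only [det3_apply, Pi.add_apply, Pi.smul_apply, smul_eq_mul]
    ring
  rw [this, slope, div_mul_eq_mul_div, eq_div_iff hu, ← sub_eq_zero (a := x * _)]
  ring_nf

/-- The case of `slope_neg` in which the vectors of `0`, `d`, `-d`, `q` are in standard position;
the concurrences with the lines through `-q` and `d - q` give the quadratic equation. -/
theorem slope_neg_of_basis (hp : IsAffineRealization p) (h3 : (3 : K) ≠ 0)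
    (h : d ≠ 0 ∧ q ≠ 0 ∧ q ≠ d ∧ q ≠ -d) (h0 : p 0 = ![1, 0, 0]) (h1 : p d = ![0, 1, 0])
    (h2 : p (-d) = ![-1, -1, 0]) (hq : p q = ![0, 0, 1]) :
    slope p d q ^ 2 - slope p d q + 1 = 0 ∧ slope p d (-q) ≠ slope p d q := by
  have n₁ := AffineSpace27.noncollinear_of_mem h
  have n₂ := AffineSpace27.noncollinear_of_mem' h
  have n₃ := AffineSpace27.ne_of_independent h
  have hd := AffineSpace27.add_add_self d
  have hne : ∀ r ∈ [q, q + d, q - d, -q, d - q], p r 2 ≠ 0 := by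
    intro r hr
    obtain ⟨h₁, h₂, h₃, h₄⟩ := n₁ r hr
    have := (hp.noncollinear _ _ _ h₁ h₂ h₃ h₄).ne_zero
    rw [h0, h1, det3_apply] at this
    simpa using this
  have hne' : ∀ r ∈ [0, d], det3 (p q) (p (q + d)) (p r) ≠ 0 := by
    intro r hr
    obtain ⟨h₁, h₂, h₃, h₄⟩ := n₂ r hr
    exact (hp.noncollinear _ _ _ h₁ h₂ h₃ h₄).ne_zero
  have b₃ := hne (q + d) (by simp)
  have c₃ := hne (q - d) (by simp)
  have e₃ := hne (-q) (by simp)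
  have f₃ := hne (d - q) (by simp)
  have b₁ := hne' d (by simp)
  have b₂ := hne' 0 (by simp)
  have k₁ := hp.det3_eq_zero (i := q) (j := q + d) (l := q - d) (n₂ 0 (by simp)).1
    (by rw [← AffineSpace27.add_add_self q]; abel)
  have k₂ := hp.det3_eq_zero (i := 0) (j := q) (l := -q) h.2.1.symm (by abel)
  have k₃ := hp.det3_eq_zero (i := d) (j := q - d) (l := -q) n₃.1 (by abel)
  have k₄ := hp.det3_eq_zero (i := -d) (j := q + d) (l := -q) n₃.2.1 (by abel)
  have k₅ := hp.det3_eq_zero (i := 0) (j := q - d) (l := d - q) n₃.2.2.1 (by abel)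
  have k₆ := hp.det3_eq_zero (i := d) (j := q + d) (l := d - q) n₃.2.2.2.1 (by rw [← hd]; abel)
  have k₇ := hp.det3_eq_zero (i := -d) (j := q) (l := d - q) n₃.2.2.2.2 (by abel)
  have hs : slope p d q = p (q + d) 0 / p (q + d) 1 := by
    rw [slope, h0, h1, hq, det3_apply, det3_apply]
    simp
  have hneg : d ≠ 0 ∧ -q ≠ 0 ∧ -q ≠ d ∧ -q ≠ -d :=
    ⟨h.1, neg_ne_zero.2 h.2.1, fun h' => h.2.2.2 (by rw [← h', neg_neg]),
      fun h' => h.2.2.1 (neg_injective h')⟩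
  have hs' : slope p d (-q) = slope p d q → det3 (p (-q)) (p (d - q))
      (slope p d q • p 0 + (1 : K) • p d) = 0 := by
    intro he
    rw [sub_eq_neg_add, hp.det3_eq_zero_iff_slope hneg, he, mul_one]
  rw [hs] at hs' ⊢
  generalize p (q + d) = b at *
  generalize p (q - d) = c at *
  generalize p (-q) = e at *
  generalize p (d - q) = f at *
  rw [hq, h1] at b₁
  rw [hq, h0] at b₂
  rw [hq] at k₁
  rw [h0, hq] at k₂
  rw [h1] at k₃
  rw [h2] at k₄
  rw [h0] at k₅
  rw [h1] at k₆
  rw [h2, hq] at k₇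
  rw [h0, h1] at hs'
  simp only [det3_apply] at *
  simp at b₁ b₂ k₁ k₂ k₃ k₄ k₅ k₆ k₇ hs'
  have E₁ : c 2 * (b 0 - b 1) = b 2 * c 0 := by
    refine mul_left_cancel₀ e₃ ?_
    linear_combination c 2 * k₄ - c 2 * b 2 * k₂ + b 2 * k₃
  have E₂ : b 2 * c 1 = b 0 * c 2 := by
    refine mul_left_cancel₀ f₃ ?_
    linear_combination b 2 * k₅ + c 2 * k₆ + c 2 * b 2 * k₇
  have E : b 0 ^ 2 - b 0 * b 1 + b 1 ^ 2 = 0 := by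
    refine mul_left_cancel₀ c₃ ?_
    linear_combination -b 1 * E₁ - b 0 * E₂ + b 2 * k₁
  refine ⟨?_, fun he => ?_⟩
  · field_simp
    linear_combination E
  · have hX := hs' he
    have hX : (b 0 - b 1) * (b 0 + b 1) = 0 := by
      have hb : b 0 / b 1 * b 1 = b 0 := div_mul_cancel₀ _ b₂
      have hX : -(e 0 * f 2) * b 1 + e 2 * f 0 * b 1 - e 2 * f 1 * b 0 = 0 := by
        linear_combination b 1 * hX - e 1 * f 2 * hb + e 2 * f 1 * hb - f 2 * b 0 * k₂
      refine mul_left_cancel₀ (mul_ne_zero e₃ f₃) ?_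
      linear_combination -b 2 * hX + f 2 * b 1 * k₄ - b 2 * b 1 * f 2 * k₂ + e 2 * b 1 * k₆ -
        e 2 * b 0 * (b 2 * k₇ + k₆)
    rcases mul_eq_zero.1 hX with h' | h'
    · apply b₁
      have : b 0 * b 0 = 0 := by linear_combination E + b 1 * h'
      simpa using this
    · have : (3 : K) * (b 0 * b 0) = 0 := by linear_combination E + (2 * b 0 - b 1) * h'
      simp [h3] at this
      exact b₁ this


/-- The slopes of the lines `q + ⟨d⟩` and `-q + ⟨d⟩` are the two roots of `x² - x + 1`; they differ
because the discriminant is `-3`. -/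
theorem slope_neg (hp : IsAffineRealization p) (h3 : (3 : K) ≠ 0)
    (h : d ≠ 0 ∧ q ≠ 0 ∧ q ≠ d ∧ q ≠ -d) (hsum : p 0 + p d + p (-d) = 0) :
    slope p d q ^ 2 - slope p d q + 1 = 0 ∧ slope p d (-q) ≠ slope p d q := by
  obtain ⟨h₁, h₂, h₃, h₄⟩ := AffineSpace27.noncollinear_of_mem h q (by simp)
  have hu := (hp.noncollinear _ _ _ h₁ h₂ h₃ h₄)
  -- the projective transformation taking `p 0, p d, p q` to the standard basis
  let M : Matrix (Fin 3) (Fin 3) K := (Matrix.of ![p 0, p d, p q]).transpose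
  have hM : IsUnit M.det := by rwa [Matrix.det_transpose]
  let g : GL (Fin 3) K := (Matrix.nonsingInvUnit M hM)⁻¹
  have hg : ∀ v w, M.mulVec v = w → (g : Matrix _ _ K).mulVec w = v := by
    rintro v _ rfl
    rw [Matrix.mulVec_mulVec]
    have : (g : Matrix (Fin 3) (Fin 3) K) * M = 1 := g.mul_inv
    rw [this, Matrix.one_mulVec]
  have hcol : ∀ v, M.mulVec v = v 0 • p 0 + v 1 • p d + v 2 • p q := by
    intro v
    ext i
    simp [M, Matrix.mulVec, dotProduct, Fin.sum_univ_three]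
    ring
  have key := (hp.mulVec g).slope_neg_of_basis h3 h (hg _ _ (by simp [hcol]))
    (hg _ _ (by simp [hcol])) (hg _ _ ?_) (hg _ _ (by simp [hcol]))
  · simpa only [slope_mulVec] using key
  · rw [hcol, ← sub_eq_zero, ← neg_eq_zero, ← hsum]
    simp
    abel

end IsAffineRealization

namespace IsAffineRealization

variable {K : Type*} [Field K] {p : AffineSpace27 → Fin 3 → K} {d q : AffineSpace27}

theorem exists_smul_add_eq_zero (hp : IsAffineRealization p)
    (h : d ≠ 0 ∧ q ≠ 0 ∧ q ≠ d ∧ q ≠ -d) : ∃ c : AffineSpace27 → Kˣ,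
      (c 0 : K) • p 0 + (c d : K) • p d + (c (-d) : K) • p (-d) = 0 := by
  have hd : d ≠ -d := by
    have : ∀ d : AffineSpace27, d ≠ 0 → d ≠ -d := by decide
    exact this d h.1
  have hu₀ := hp.isUnit_det3_zero h.1 h.2.1 h.2.2.1.symm
    fun h' => h.2.2.2 (by rw [h', neg_neg])
  have hu₁ := hp.isUnit_det3_zero (neg_ne_zero.2 h.1) h.2.1 h.2.2.2.symm
    fun h' => h.2.2.1 (neg_injective h').symm
  have hu₂ := hp.noncollinear (-d) d q hd.symm h.2.2.1.symm h.2.2.2.symm (by simpa using h.2.1)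
  have hz := hp.det3_eq_zero (i := 0) (j := d) (l := -d) h.1.symm (by simp)
  refine ⟨fun t => if t = 0 then -hu₂.unit else if t = d then -hu₁.unit else hu₀.unit, ?_⟩
  simp only [if_true, h.1, hd.symm, neg_eq_zero, if_false, Units.val_neg, IsUnit.unit_spec]
  rw [det3_smul_eq (p 0) (p d) (p q), hz]
  module

theorem comp_add (hp : IsAffineRealization p) (r : AffineSpace27) :
    IsAffineRealization fun t => p (t + r) := by
  have hr : ∀ i j l, i + r + (j + r) + (l + r) = i + j + l := fun i j l => by
    rw [← add_zero (i + j + l), ← AffineSpace27.add_add_self r]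
    abel
  have hne : ∀ {i j}, i ≠ j → i + r ≠ j + r := fun h => (add_left_injective r).ne h
  exact ⟨fun i j l h₁ h₂ h₃ h₀ => hp.collinear _ _ _ (hne h₁) (hne h₂) (hne h₃) (by rwa [hr]),
    fun i j l h₁ h₂ h₃ h₀ => hp.noncollinear _ _ _ (hne h₁) (hne h₂) (hne h₃) (by rwa [hr])⟩

theorem eq_zero_of_parallel_neg (hp : IsAffineRealization p) (h3 : (3 : K) ≠ 0)
    (h : d ≠ 0 ∧ q ≠ 0 ∧ q ≠ d ∧ q ≠ -d) {x : Fin 3 → K} (h0 : det3 (p 0) (p d) x = 0)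
    (h1 : det3 (p q) (p (q + d)) x = 0) (h2 : det3 (p (-q)) (p (-q + d)) x = 0) : x = 0 := by
  obtain ⟨c, hc⟩ := hp.exists_smul_add_eq_zero h
  let p' : AffineSpace27 → Fin 3 → K := fun t => (c t : K) • p t
  have hp' : IsAffineRealization p' := hp.smul c
  have hdet : ∀ s t, det3 (p s) (p t) x = 0 → det3 (p' s) (p' t) x = 0 := by
    intro s t h
    have := det3_smul (c s : K) (c t) 1 (p s) (p t) x
    rwa [one_smul, h, mul_zero] at this
  have hneg : d ≠ 0 ∧ -q ≠ 0 ∧ -q ≠ d ∧ -q ≠ -d :=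
    ⟨h.1, neg_ne_zero.2 h.2.1, fun h' => h.2.2.2 (by rw [← h', neg_neg]),
      fun h' => h.2.2.1 (neg_injective h')⟩
  have hu := hp'.isUnit_det3_zero h.1 h.2.1 h.2.2.1.symm
    fun h' => h.2.2.2 (by rw [h', neg_neg])
  obtain ⟨a, b, e, rfl⟩ := exists_eq_of_isUnit_det3 hu x
  have he : e = 0 := by
    refine (hu.mul_left_eq_zero).1 ?_
    rw [← hdet _ _ h0]
    simp only [det3_apply, Pi.add_apply, Pi.smul_apply, smul_eq_mul]
    ring
  subst he
  have h1 := hdet _ _ h1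
  have h2 := hdet _ _ h2
  rw [zero_smul, add_zero] at h1 h2 ⊢
  rw [hp'.det3_eq_zero_iff_slope h] at h1
  rw [hp'.det3_eq_zero_iff_slope hneg] at h2
  have hs := (hp'.slope_neg h3 h hc).2
  have hb : b = 0 := by
    rw [h1, ← sub_eq_zero, ← sub_mul] at h2
    exact (mul_eq_zero.1 h2).resolve_left (sub_ne_zero.2 hs.symm)
  rw [h1, hb, mul_zero, zero_smul, zero_smul, add_zero]

/-- Three parallel lines in a plane are not concurrent. -/
theorem eq_zero_of_parallel (hp : IsAffineRealization p) (h3 : (3 : K) ≠ 0)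
    {r s t : AffineSpace27} (hrst : r + s + t = 0)
    (h : d ≠ 0 ∧ s - r ≠ 0 ∧ s - r ≠ d ∧ s - r ≠ -d) {x : Fin 3 → K}
    (hr : det3 (p r) (p (r + d)) x = 0) (hs : det3 (p s) (p (s + d)) x = 0)
    (ht : det3 (p t) (p (t + d)) x = 0) : x = 0 := by
  refine (hp.comp_add r).eq_zero_of_parallel_neg h3 h (x := x) ?_ ?_ ?_
  · rwa [zero_add, add_comm d]
  · rwa [sub_add_cancel, add_right_comm, sub_add_cancel]
  · have h' : -(s - r) + r = t := by
      rw [← sub_eq_zero, ← neg_eq_zero, ← hrst, ← sub_eq_zero, ← neg_eq_zero,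
        ← AffineSpace27.add_add_self r]
      abel
    rwa [add_right_comm, h']

/-- The matroid of `AG(3, 3)`, truncated to rank `3`, has no realization in characteristic
different from `3`.  Let `ℓ` be a line.  Otherwise every line parallel to `ℓ` meets `ℓ` in one of
two points, and `q + ℓ` and `-q + ℓ` pass through different ones.  Choose independent directions
`s, t` such that `s + ℓ` and `t + ℓ` pass through the same point `X`.  As no three parallel coplanar
lines are concurrent, `-(s + t) + ℓ` does not pass through `X`, hence `s + t + ℓ` does.  Now
`s - t + ℓ` does not pass through `X`, being coplanar with `s + ℓ` and `s + t + ℓ`, and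
`t - s + ℓ` does not, being coplanar with `t + ℓ` and `s + t + ℓ`: a contradiction. -/
theorem three_eq_zero (hp : IsAffineRealization p) : (3 : K) = 0 := by
  by_contra h3
  obtain ⟨c, hc⟩ := hp.exists_smul_add_eq_zero (d := (0, 0, 1)) (q := (1, 0, 0)) (by decide)
  obtain ⟨p', hp', hsum⟩ : ∃ p' : AffineSpace27 → Fin 3 → K, IsAffineRealization p' ∧
      p' 0 + p' (0, 0, 1) + p' (-(0, 0, 1)) = 0 := ⟨_, hp.smul c, hc⟩
  obtain ⟨d, hd⟩ : ∃ d : AffineSpace27, d = (0, 0, 1) := ⟨_, rfl⟩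
  rw [← hd] at hsum
  obtain ⟨ρ, hρ⟩ : ∃ ρ, ρ = slope p' d (1, 0, 0) := ⟨_, rfl⟩
  have hroot := (hp'.slope_neg h3 (q := (1, 0, 0)) (by subst hd; decide) hsum).1
  rw [← hρ] at hroot
  have hor : ∀ q, d ≠ 0 ∧ q ≠ 0 ∧ q ≠ d ∧ q ≠ -d → slope p' d q = ρ ∨ slope p' d (-q) = ρ := by
    intro q hq
    obtain ⟨h₁, hne⟩ := hp'.slope_neg h3 hq hsum
    obtain ⟨h₂, -⟩ := hp'.slope_neg h3 (q := -q) ⟨hq.1, neg_ne_zero.2 hq.2.1,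
      fun h' => hq.2.2.2 (by rw [← h', neg_neg]), fun h' => hq.2.2.1 (neg_injective h')⟩ hsum
    rw [← sub_eq_zero, ← sub_eq_zero (a := slope p' d (-q)), ← mul_eq_zero]
    refine (mul_eq_zero.1 ?_).resolve_left (sub_ne_zero.2 hne)
    grind
  have hX : ρ • p' 0 + (1 : K) • p' d ≠ 0 := by
    intro h0
    have hu := hp'.isUnit_det3_zero (s := d) (t := (1, 0, 0)) (by subst hd; decide) (by decide)
      (by subst hd; decide) (by subst hd; decide)
    refine hu.ne_zero ?_
    have : p' d = -ρ • p' 0 := by rw [← sub_eq_zero, ← h0]; module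
    rw [this, det3_apply]
    simp
    ring
  -- three lines through the point are not coplanar
  have key : ∀ r s t : AffineSpace27, (r + s + t = 0 ∧ (d ≠ 0 ∧ r ≠ 0 ∧ r ≠ d ∧ r ≠ -d) ∧
      (d ≠ 0 ∧ s ≠ 0 ∧ s ≠ d ∧ s ≠ -d) ∧ (d ≠ 0 ∧ t ≠ 0 ∧ t ≠ d ∧ t ≠ -d) ∧
      (d ≠ 0 ∧ s - r ≠ 0 ∧ s - r ≠ d ∧ s - r ≠ -d)) →
      slope p' d r = ρ → slope p' d s = ρ → slope p' d t ≠ ρ := by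
    rintro r s t ⟨hrst, ir, is, it, irs⟩ hr hs ht
    refine hX (hp'.eq_zero_of_parallel h3 hrst irs ?_ ?_ ?_)
    · rw [hp'.det3_eq_zero_iff_slope ir, hr, mul_one]
    · rw [hp'.det3_eq_zero_iff_slope is, hs, mul_one]
    · rw [hp'.det3_eq_zero_iff_slope it, ht, mul_one]
  have final : ∀ t : AffineSpace27, t = (0, 1, 0) ∨ t = (0, -1, 0) → slope p' d t ≠ ρ := by
    intro t ht h₂
    have h₁ := hρ.symm
    have h₃ : slope p' d ((1, 0, 0) + t) = ρ :=
      (hor _ (by subst hd; rcases ht with rfl | rfl <;> decide)).resolve_right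
        (key (1, 0, 0) t _ (by subst hd; rcases ht with rfl | rfl <;> decide) h₁ h₂)
    rcases hor ((1, 0, 0) - t) (by subst hd; rcases ht with rfl | rfl <;> decide) with h₄ | h₄
    · exact key _ _ _ (by subst hd; rcases ht with rfl | rfl <;> decide) h₁ h₃ h₄
    · exact key _ _ _ (by subst hd; rcases ht with rfl | rfl <;> decide) h₂ h₃ h₄
  rcases hor (0, 1, 0) (by subst hd; decide) with h | h
  · exact final _ (Or.inl rfl) h
  · exact final _ (Or.inr (by decide)) h

end IsAffineRealization

/-! ### Labels in a field with at least `27` elements -/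

theorem exists_injective_addMonoidHom {F : Type*} [Field F] {n : ℕ} (hn : 3 ≤ n)
    (hF : Nat.card F = 3 ^ n) : ∃ f : AffineSpace27 →+ F, Function.Injective f := by
  have := charP_three_of_card hF
  have : Fact (Nat.Prime 3) := ⟨Nat.prime_three⟩
  have : Finite F := Nat.finite_of_card_ne_zero (by rw [hF]; positivity)
  let _ : Algebra (ZMod 3) F := ZMod.algebra F 3
  have hrank : Module.finrank (ZMod 3) F = n := by
    have h := Module.natCard_eq_pow_finrank (K := ZMod 3) (V := F)
    rw [hF, Nat.card_zmod] at h
    exact (Nat.pow_right_injective (a := 3) (by norm_num) h).symm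
  have : ∃ f : AffineSpace27 →ₗ[ZMod 3] F, Function.Injective f := by
    rw [← lift_rank_le_iff_exists_linearMap, ← Module.finrank_eq_rank, ← Module.finrank_eq_rank]
    simpa [hrank] using hn
  obtain ⟨f, hf⟩ := this
  exact ⟨f.toAddMonoidHom, hf⟩

theorem exists_addEquiv {F : Type*} [Field F] (hF : Nat.card F = 27) :
    Nonempty (F ≃+ AffineSpace27) := by
  obtain ⟨f, hf⟩ := exists_injective_addMonoidHom (n := 3) le_rfl hF
  have : Finite F := Nat.finite_of_card_ne_zero (by rw [hF]; norm_num)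
  have hb : Function.Bijective f := (Nat.bijective_iff_injective_and_card f).2 ⟨hf, by
    rw [hF]
    simp⟩
  exact ⟨(AddEquiv.ofBijective f hb).symm⟩

theorem ringChar_eq_three_of_realizes {F K : Type*} [Field F] [Field K] {n : ℕ} (hn : 3 ≤ n)
    (hF : Nat.card F = 3 ^ n) {L : F → ℙ K (Fin 3 → K)} (hL : Realizes L (cuspidalMatroid F)) :
    ringChar K = 3 := by
  obtain ⟨f, hf⟩ := exists_injective_addMonoidHom hn hF
  have hp : IsAffineRealization fun t => (L t).rep := by
    have : ∀ i j l : F, i ≠ j → j ≠ l → i ≠ l →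
        (det3 (L i).rep (L j).rep (L l).rep = 0 ↔ i + j + l = 0) := fun i j l h₁ h₂ h₃ => by
      rw [det3, ← triple_mem_arrangementMatroid_iff_det h₁ h₂ h₃, hL.2,
        triple_mem_cuspidalMatroid_iff h₁ h₂ h₃]
    exact ⟨fun i j l h₁ h₂ h₃ => (this i j l h₁ h₂ h₃).2,
      fun i j l h₁ h₂ h₃ h₀ => isUnit_iff_ne_zero.2 (mt (this i j l h₁ h₂ h₃).1 h₀)⟩
  have h3 : ((3 : ℕ) : K) = 0 := by exact_mod_cast (hp.comp f hf).three_eq_zero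
  have : Fact (Nat.Prime 3) := ⟨Nat.prime_three⟩
  exact ringChar.eq_iff.2 (CharP.charP_iff_prime_eq_zero Nat.prime_three |>.2 h3)

/-! ### Krull dimension and nilpotent extensions -/

theorem ringKrullDim_quotient_add_one_le {R : Type*} [CommRing R] {I J : Ideal R} [I.IsPrime]
    (h : I < J) : ringKrullDim (R ⧸ J) + 1 ≤ ringKrullDim (R ⧸ I) := by
  obtain ⟨r, hrJ, hrI⟩ := SetLike.exists_of_lt h
  refine ringKrullDim_succ_le_of_surjective (Ideal.Quotient.factor h.le)
    (Ideal.Quotient.factor_surjective h.le) (r := Ideal.Quotient.mk I r) ?_ ?_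
  · rw [mem_nonZeroDivisors_iff_ne_zero, Ne, Ideal.Quotient.eq_zero_iff_mem]
    exact hrI
  · rw [Ideal.Quotient.factor_mk]
    exact Ideal.Quotient.eq_zero_iff_mem.2 hrJ

theorem ringKrullDim_quotient_radical {R : Type*} [CommRing R] (I : Ideal R) :
    ringKrullDim (R ⧸ I.radical) = ringKrullDim (R ⧸ I) := by
  rw [ringKrullDim_quotient, ringKrullDim_quotient, PrimeSpectrum.zeroLocus_radical]

theorem ringKrullDim_quotient_nilradical (R : Type*) [CommRing R] :
    ringKrullDim (R ⧸ nilradical R) = ringKrullDim R := by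
  rw [nilradical, ringKrullDim_quotient_radical, Ideal.zero_eq_bot]
  exact ringKrullDim_eq_of_ringEquiv (RingEquiv.quotientBot R)

theorem ringKrullDim_le_of_isLocalization {R S : Type*} [CommRing R] [CommRing S] [Algebra R S]
    (M : Submonoid R) [IsLocalization M S] : ringKrullDim S ≤ ringKrullDim R := by
  refine Order.krullDim_le_of_strictMono (PrimeSpectrum.comap (algebraMap R S))
    (Monotone.strictMono_of_injective (fun p q h => Ideal.comap_mono h)
      (PrimeSpectrum.localization_comap_injective S M))

/-! ### An embedded component of a trivial square-zero extension -/

namespace TrivSqZeroExt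

variable {P : Type*} [CommRing P] (I : Ideal P)

theorem smul_quotient_eq_zero_iff [I.IsPrime] {a : P} {m : P ⧸ I} :
    a • m = 0 ↔ a ∈ I ∨ m = 0 := by
  obtain ⟨m, rfl⟩ := Ideal.Quotient.mk_surjective m
  rw [← Ideal.Quotient.mk_eq_mk, ← Submodule.Quotient.mk_smul, Ideal.Quotient.mk_eq_mk,
    Ideal.Quotient.eq_zero_iff_mem, Ideal.Quotient.mk_eq_mk, Ideal.Quotient.eq_zero_iff_mem,
    smul_eq_mul]
  exact Ideal.IsPrime.mul_mem_iff_mem_or_mem inferInstance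

theorem smul_quotient_eq_zero {a : P} (ha : a ∈ I) (m : P ⧸ I) : a • m = 0 := by
  obtain ⟨m, rfl⟩ := Ideal.Quotient.mk_surjective m
  rw [← Ideal.Quotient.mk_eq_mk, ← Submodule.Quotient.mk_smul, Ideal.Quotient.mk_eq_mk,
    Ideal.Quotient.eq_zero_iff_mem, smul_eq_mul]
  exact I.mul_mem_right m ha

/-- The ideal generated by `I` in the trivial square-zero extension of `P` by `P ⧸ I`; the
quotient by it consists of the dual numbers over `P ⧸ I`. -/
def extendedIdeal : Ideal (TrivSqZeroExt P (P ⧸ I)) where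
  carrier := {x | x.fst ∈ I ∧ x.snd = 0}
  zero_mem' := ⟨I.zero_mem, rfl⟩
  add_mem' hx hy := ⟨I.add_mem hx.1 hy.1, by simp [hx.2, hy.2]⟩
  smul_mem' c x hx := ⟨by simpa using I.mul_mem_left _ hx.1, by
    simp [hx.2, smul_quotient_eq_zero I hx.1]⟩

theorem mem_extendedIdeal {x : TrivSqZeroExt P (P ⧸ I)} :
    x ∈ extendedIdeal I ↔ x.fst ∈ I ∧ x.snd = 0 :=
  Iff.rfl

theorem sq_mem_extendedIdeal {x : TrivSqZeroExt P (P ⧸ I)} (h : x.fst ∈ I) :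
    x ^ 2 ∈ extendedIdeal I := by
  rw [sq, mem_extendedIdeal]
  refine ⟨by simpa using I.mul_mem_left _ h, ?_⟩
  simp [smul_quotient_eq_zero I h]

theorem radical_extendedIdeal [hI : I.IsPrime] :
    (extendedIdeal I).radical = I.comap (fstHom P P (P ⧸ I)) := by
  apply le_antisymm
  · refine (Ideal.IsPrime.radical_le_iff inferInstance).2 fun x hx => hx.1
  · exact fun x hx => ⟨2, sq_mem_extendedIdeal I hx⟩

theorem isPrimary_extendedIdeal [hI : I.IsPrime] : (extendedIdeal I).IsPrimary := by
  rw [Ideal.isPrimary_iff]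
  refine ⟨fun h => hI.ne_top ((Ideal.eq_top_iff_one I).2 ?_), fun {x y} hxy => ?_⟩
  · have : (1 : TrivSqZeroExt P (P ⧸ I)) ∈ extendedIdeal I := by rw [h]; trivial
    exact this.1
  · by_cases hy : y.fst ∈ I
    · exact Or.inr ⟨2, sq_mem_extendedIdeal I hy⟩
    left
    obtain ⟨h1, h2⟩ := hxy
    rw [fst_mul] at h1
    have hx : x.fst ∈ I := (hI.mem_or_mem h1).resolve_right hy
    rw [snd_mul, smul_quotient_eq_zero I hx, zero_add, op_smul_eq_smul,
      smul_quotient_eq_zero_iff] at h2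
    exact ⟨hx, h2.resolve_left hy⟩

theorem not_isRadical_extendedIdeal [hI : I.IsPrime] : ¬ (extendedIdeal I).IsRadical := by
  intro h
  have : (inr 1 : TrivSqZeroExt P (P ⧸ I)) ∈ extendedIdeal I :=
    h ⟨2, sq_mem_extendedIdeal I (by simp)⟩
  exact one_ne_zero this.2

theorem isPrime_kerIdeal [IsDomain P] : (kerIdeal P (P ⧸ I)).IsPrime :=
  RingHom.ker_isPrime _

theorem nilradical_eq_kerIdeal [IsDomain P] :
    nilradical (TrivSqZeroExt P (P ⧸ I)) = kerIdeal P (P ⧸ I) := by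
  have := isPrime_kerIdeal I
  apply le_antisymm
  · exact nilradical_le_prime _
  · intro x hx
    refine ⟨2, ?_⟩
    have : x ^ 2 ∈ kerIdeal P (P ⧸ I) ^ 2 := Ideal.pow_mem_pow hx 2
    rwa [kerIdeal_sq] at this

/-- The zero ideal is the intersection of the nilradical and of the ideal generated by `I`. -/
theorem exists_isMinimalPrimaryDecomposition [IsDomain P] [hI : I.IsPrime] (h0 : I ≠ ⊥) :
    ∃ t : Finset (Ideal (TrivSqZeroExt P (P ⧸ I))),
      Submodule.IsMinimalPrimaryDecomposition ⊥ t ∧ extendedIdeal I ∈ t := by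
  classical
  have hker := isPrime_kerIdeal I
  have hprim := isPrimary_extendedIdeal I
  obtain ⟨a, haI, ha0⟩ := Submodule.exists_mem_ne_zero_of_ne_bot h0
  have hrad : (kerIdeal P (P ⧸ I)).radical ≠ (extendedIdeal I).radical := by
    rw [hker.radical, radical_extendedIdeal]
    intro h
    have : (inl a : TrivSqZeroExt P (P ⧸ I)) ∈ kerIdeal P (P ⧸ I) := by rw [h]; exact haI
    exact ha0 this
  have hne : kerIdeal P (P ⧸ I) ≠ extendedIdeal I := fun h => hrad (by rw [h])
  have hle : ¬ extendedIdeal I ≤ kerIdeal P (P ⧸ I) := fun h =>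
    ha0 (h (show (inl a : TrivSqZeroExt P (P ⧸ I)) ∈ extendedIdeal I from ⟨haI, rfl⟩))
  have hle' : ¬ kerIdeal P (P ⧸ I) ≤ extendedIdeal I := fun h =>
    one_ne_zero (h (show (inr 1 : TrivSqZeroExt P (P ⧸ I)) ∈ kerIdeal P (P ⧸ I) from rfl)).2
  refine ⟨{kerIdeal P (P ⧸ I), extendedIdeal I}, ⟨?_, ?_, ?_, ?_⟩, by simp⟩
  · rw [Finset.inf_insert, Finset.inf_singleton]
    refine eq_bot_iff.2 fun x hx => ?_
    exact TrivSqZeroExt.ext hx.1 hx.2.2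
  · intro J hJ
    rw [Finset.mem_insert, Finset.mem_singleton] at hJ
    rcases hJ with rfl | rfl
    · exact hker.isPrimary
    · exact hprim
  · rw [Finset.coe_insert, Finset.coe_singleton, Set.pairwise_pair]
    have hcolon : ∀ J : Ideal (TrivSqZeroExt P (P ⧸ I)), J.colon Set.univ = J := fun J => by
      ext x
      rw [Submodule.mem_colon]
      exact ⟨fun h => by simpa using h 1 trivial, fun h y _ => J.mul_mem_right y h⟩
    intro _
    simp only [Function.onFun, hcolon]
    exact ⟨hrad, hrad.symm⟩
  · intro J hJ
    rw [Finset.mem_insert, Finset.mem_singleton] at hJ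
    rcases hJ with rfl | rfl
    · rw [Finset.erase_insert (by simpa using hne)]
      simpa using hle
    · rw [Finset.pair_comm, Finset.erase_insert (by simpa using hne.symm)]
      simpa using hle'

theorem isEmbeddedComponent_extendedIdeal [IsDomain P] [hI : I.IsPrime] (h0 : I ≠ ⊥) :
    IsEmbeddedComponent (extendedIdeal I) := by
  refine ⟨exists_isMinimalPrimaryDecomposition I h0, fun h => ?_⟩
  have hker := isPrime_kerIdeal I
  obtain ⟨a, haI, ha0⟩ := Submodule.exists_mem_ne_zero_of_ne_bot h0
  rw [radical_extendedIdeal] at h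
  have hle : kerIdeal P (P ⧸ I) ≤ I.comap (fstHom P P (P ⧸ I)) := fun x hx => by
    have : x.fst = 0 := hx
    change x.fst ∈ I
    rw [this]
    exact I.zero_mem
  exact ha0 (h.2 ⟨hker, bot_le⟩ hle (show (inl a : TrivSqZeroExt P (P ⧸ I)) ∈ _ from haI))

theorem ringKrullDim_eq [IsDomain P] :
    ringKrullDim (TrivSqZeroExt P (P ⧸ I)) = ringKrullDim P := by
  rw [← ringKrullDim_quotient_nilradical, nilradical_eq_kerIdeal]
  exact ringKrullDim_eq_of_ringEquiv (RingHom.quotientKerEquivOfSurjective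
    (f := (fstHom P P (P ⧸ I)).toRingHom) fst_surjective)

theorem ringKrullDim_quotient_extendedIdeal [hI : I.IsPrime] :
    ringKrullDim (TrivSqZeroExt P (P ⧸ I) ⧸ extendedIdeal I) = ringKrullDim (P ⧸ I) := by
  rw [← ringKrullDim_quotient_radical, radical_extendedIdeal]
  let f : TrivSqZeroExt P (P ⧸ I) →+* P ⧸ I :=
    (Ideal.Quotient.mk I).comp (fstHom P P (P ⧸ I)).toRingHom
  have hf : RingHom.ker f = I.comap (fstHom P P (P ⧸ I)) := by
    rw [← RingHom.comap_ker, Ideal.mk_ker]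
    rfl
  rw [← hf]
  exact ringKrullDim_eq_of_ringEquiv (RingHom.quotientKerEquivOfSurjective
    (Ideal.Quotient.mk_surjective.comp fst_surjective))

/-! ### Homomorphisms from a trivial square-zero extension -/

theorem inr_one_mul_inl {a : P} (ha : a ∈ I) :
    (inr 1 : TrivSqZeroExt P (P ⧸ I)) * inl a = 0 := by
  rw [inr_mul_inl, op_smul_eq_smul, smul_quotient_eq_zero I ha, inr_zero]

variable {I} {S A : Type*} [CommRing S] [Algebra S P] [CommRing A] [Algebra S A]

theorem algHom_ext_quotient {φ ψ : TrivSqZeroExt P (P ⧸ I) →ₐ[S] A}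
    (h : ∀ p, φ (inl p) = ψ (inl p)) (hε : φ (inr 1) = ψ (inr 1)) : φ = ψ := by
  apply AlgHom.ext
  intro x
  obtain ⟨p, hp⟩ := Ideal.Quotient.mk_surjective x.snd
  have hx : x = inl x.fst + inl p * inr 1 := by
    apply TrivSqZeroExt.ext
    · simp
    · simp only [snd_add, snd_inl, zero_add, inl_mul_inr, snd_inr, ← hp]
      rw [← map_one (Ideal.Quotient.mk _), ← Ideal.Quotient.mk_eq_mk, ← Ideal.Quotient.mk_eq_mk,
        ← Submodule.Quotient.mk_smul, smul_eq_mul, mul_one]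
  rw [hx, map_add, map_add, map_mul, map_mul, h, h, hε]

theorem exists_algHom_quotient (f : P →ₐ[S] A) {ε : A} (h2 : ε ^ 2 = 0)
    (hI : ∀ a ∈ I, f a * ε = 0) :
    ∃ φ : TrivSqZeroExt P (P ⧸ I) →ₐ[S] A, (∀ p, φ (inl p) = f p) ∧ φ (inr 1) = ε := by
  let _ : Algebra P A := f.toAlgebra
  have : IsScalarTower S P A := IsScalarTower.of_algHom f
  let m : (P ⧸ I) →ₗ[P] A := Submodule.liftQ I (LinearMap.toSpanSingleton P A ε) hI
  have hm : ∀ p, m (Ideal.Quotient.mk I p) = f p * ε := fun p => rfl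
  have hsmul : ∀ (r : P) (x : P ⧸ I), m (r • x) = f r * m x := fun r x => by
    rw [map_smul, Algebra.smul_def]
    rfl
  refine ⟨TrivSqZeroExt.lift f (m.restrictScalars S) (fun x y => ?_) hsmul (fun r x => ?_),
    fun p => ?_, ?_⟩
  · obtain ⟨x, rfl⟩ := Ideal.Quotient.mk_surjective x
    obtain ⟨y, rfl⟩ := Ideal.Quotient.mk_surjective y
    simp only [LinearMap.restrictScalars_apply, hm]
    linear_combination f x * f y * h2
  · rw [op_smul_eq_smul, mul_comm]
    exact hsmul r x
  · exact lift_apply_inl ..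
  · exact (lift_apply_inr ..).trans ((hm 1).trans (by rw [map_one, one_mul]))

end TrivSqZeroExt

/-! ### The realization ring -/

theorem map_normalForm {A B : Type*} [CommRing A] [CommRing B] (g : A →+* B)
    (κ : ZMod 3 →+* A) (κ' : ZMod 3 →+* B) (u v w ε : A) (t : AffineSpace27) :
    g ∘ normalForm κ u v w ε t = normalForm κ' (g u) (g v) (g w) (g ε) t := by
  obtain rfl : κ' = g.comp κ := Subsingleton.elim _ _
  ext i
  fin_cases i <;> simp [normalForm, firstCoord, secondCoord, thirdCoord]

/-- Whether a normal form is a realization can be tested modulo the nilpotent `ε`. -/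
theorem isAffineRealization_normalForm_iff {A : Type*} [CommRing A] {κ : ZMod 3 →+* A}
    {u v w ε : A} (h2 : ε ^ 2 = 0) (hw : ε * w = 0) :
    IsAffineRealization (normalForm κ u v w ε) ↔ IsAffineRealization (normalForm κ u v w 0) := by
  let q := Ideal.Quotient.mk (Ideal.span {ε})
  have hq : ∀ x : A, IsUnit (q x) ↔ IsUnit x := fun x =>
    IsNilpotent.isUnit_quotient_mk_iff ⟨2, by
      rw [Ideal.span_singleton_pow, h2]
      simp⟩
  have key : ∀ i j l, IsUnit (det3 (normalForm κ u v w ε i) (normalForm κ u v w ε j)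
      (normalForm κ u v w ε l)) ↔ IsUnit (det3 (normalForm κ u v w 0 i) (normalForm κ u v w 0 j)
      (normalForm κ u v w 0 l)) := fun i j l => by
    have h0 : q ε = 0 := Ideal.Quotient.eq_zero_iff_mem.2 (Ideal.mem_span_singleton_self ε)
    rw [← hq, ← hq, map_det3, map_det3]
    simp only [map_normalForm q κ (q.comp κ), h0, map_zero]
  constructor
  · exact fun h => ⟨fun i j l _ _ _ h₀ => det3_normalForm_eq_zero (by simp) (by simp) h₀,
      fun i j l h₁ h₂ h₃ h₀ => (key i j l).1 (h.noncollinear i j l h₁ h₂ h₃ h₀)⟩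
  · exact fun h => ⟨fun i j l _ _ _ h₀ => det3_normalForm_eq_zero h2 hw h₀,
      fun i j l h₁ h₂ h₃ h₀ => (key i j l).2 (h.noncollinear i j l h₁ h₂ h₃ h₀)⟩

section RealizationRing

variable {k : Type*} [Field k] (κ : ZMod 3 →+* k)

/-- The polynomial in the parameters `u, v, w` whose zeros are the degenerate projections of
`AG(3, 3)` to the plane, in which some non-collinear triple becomes collinear. -/
noncomputable def degeneracy : MvPolynomial (Fin 3) k :=
  ∏ x : {x : AffineSpace27 × AffineSpace27 × AffineSpace27 //
      x.1 ≠ x.2.1 ∧ x.2.1 ≠ x.2.2 ∧ x.1 ≠ x.2.2 ∧ x.1 + x.2.1 + x.2.2 ≠ 0},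
    det3 (normalForm (C.comp κ) (X 0) (X 1) (X 2) 0 x.1.1)
      (normalForm (C.comp κ) (X 0) (X 1) (X 2) 0 x.1.2.1)
      (normalForm (C.comp κ) (X 0) (X 1) (X 2) 0 x.1.2.2)

theorem isUnit_map_degeneracy_iff {A : Type*} [CommRing A] (g : MvPolynomial (Fin 3) k →+* A)
    (κ' : ZMod 3 →+* A) : IsUnit (g (degeneracy κ)) ↔
      IsAffineRealization (normalForm κ' (g (X 0)) (g (X 1)) (g (X 2)) 0) := by
  rw [degeneracy, map_prod, IsUnit.prod_univ_iff]
  simp only [map_det3, map_normalForm g (C.comp κ) κ', map_zero]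
  constructor
  · exact fun h => ⟨fun i j l _ _ _ h₀ => det3_normalForm_eq_zero (by simp) (by simp) h₀,
      fun i j l h₁ h₂ h₃ h₀ => h ⟨(i, j, l), h₁, h₂, h₃, h₀⟩⟩
  · rintro h ⟨⟨i, j, l⟩, h₁, h₂, h₃, h₀⟩
    exact h.noncollinear i j l h₁ h₂ h₃ h₀

/-- The coordinate ring of the space of non-degenerate projections of `AG(3, 3)`. -/
abbrev ProjectionRing : Type _ := Localization.Away (degeneracy κ)

/-- The parameters `u, v, w` in the coordinate ring. -/
noncomputable def param (i : Fin 3) : ProjectionRing κ :=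
  algebraMap _ _ (X i : MvPolynomial (Fin 3) k)

/-- The ideal of the locus `w = 0`, where the center of projection lies in the plane at infinity
of `AG(3, 3)`, i.e. where the projection is given by an affine map to the plane. -/
noncomputable def affineLocus : Ideal (ProjectionRing κ) := Ideal.span {param κ 2}

/-- The coordinate ring of the realization space: it is generated over the ring of projections by
the parameter `ε` of `normalForm` with the relations `ε ^ 2 = 0` and `ε * w = 0`. -/
abbrev RealizationRing : Type _ :=
  TrivSqZeroExt (ProjectionRing κ) (ProjectionRing κ ⧸ affineLocus κ)

namespace RealizationRing

/-- The nilpotent parameter. -/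
noncomputable def eps : RealizationRing κ := TrivSqZeroExt.inr 1

/-- The parameters of the projection. -/
noncomputable def coord (i : Fin 3) : RealizationRing κ := TrivSqZeroExt.inl (param κ i)

theorem eps_sq : eps κ ^ 2 = 0 := by
  rw [sq, eps, TrivSqZeroExt.inr_mul_inr]

theorem eps_mul_coord : eps κ * coord κ 2 = 0 :=
  TrivSqZeroExt.inr_one_mul_inl _ (Ideal.mem_span_singleton_self _)

/-- The universal realization. -/
noncomputable def universal : AffineSpace27 → Fin 3 → RealizationRing κ :=
  normalForm ((algebraMap k (RealizationRing κ)).comp κ) (coord κ 0) (coord κ 1) (coord κ 2) (eps κ)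

theorem isAffineRealization_universal : IsAffineRealization (universal κ) := by
  rw [universal, isAffineRealization_normalForm_iff (eps_sq κ) (eps_mul_coord κ)]
  let g : MvPolynomial (Fin 3) k →+* RealizationRing κ :=
    (TrivSqZeroExt.inlHom _ _).comp (algebraMap _ (ProjectionRing κ))
  refine (isUnit_map_degeneracy_iff κ g _).1 ?_
  exact (IsLocalization.Away.algebraMap_isUnit (degeneracy κ)).map (TrivSqZeroExt.inlHom _ _)

variable {κ}

theorem algHom_ext {A : Type*} [CommRing A] [Algebra k A] {φ ψ : RealizationRing κ →ₐ[k] A}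
    (h : ∀ i, φ (coord κ i) = ψ (coord κ i)) (hε : φ (eps κ) = ψ (eps κ)) : φ = ψ := by
  refine TrivSqZeroExt.algHom_ext_quotient (fun p => ?_) hε
  have : φ.comp (TrivSqZeroExt.inlAlgHom k _ _) = ψ.comp (TrivSqZeroExt.inlAlgHom k _ _) := by
    refine IsLocalization.algHom_ext (Submonoid.powers (degeneracy κ)) ?_
    refine MvPolynomial.algHom_ext fun i => ?_
    exact h i
  exact congrArg (fun f => f p) this

theorem exists_algHom {A : Type*} [CommRing A] [Algebra k A] {u v w ε : A} (h2 : ε ^ 2 = 0)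
    (hw : ε * w = 0) {κ' : ZMod 3 →+* A} (h : IsAffineRealization (normalForm κ' u v w ε)) :
    ∃ φ : RealizationRing κ →ₐ[k] A, φ (coord κ 0) = u ∧ φ (coord κ 1) = v ∧
      φ (coord κ 2) = w ∧ φ (eps κ) = ε := by
  rw [isAffineRealization_normalForm_iff h2 hw] at h
  let g : MvPolynomial (Fin 3) k →ₐ[k] A := aeval ![u, v, w]
  have hg : IsUnit (g (degeneracy κ)) := (isUnit_map_degeneracy_iff κ g.toRingHom κ').2 (by
    simpa [g] using h)
  let f : ProjectionRing κ →ₐ[k] A := IsLocalization.liftAlgHom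
    (M := Submonoid.powers (degeneracy κ)) (f := g) (by
      rintro ⟨_, n, rfl⟩
      simpa using hg.pow n)
  have hf : ∀ i, f (param κ i) = ![u, v, w] i := fun i => by
    simp [f, param, g]
  obtain ⟨φ, hφ, hε⟩ := TrivSqZeroExt.exists_algHom_quotient (I := affineLocus κ) f h2 (by
    intro a ha
    obtain ⟨b, rfl⟩ := Ideal.mem_span_singleton'.1 ha
    rw [map_mul, hf, mul_assoc, mul_comm _ ε]
    change f b * (ε * w) = 0
    rw [hw, mul_zero])
  exact ⟨φ, (hφ _).trans (hf 0), (hφ _).trans (hf 1), (hφ _).trans (hf 2), hε⟩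

end RealizationRing

end RealizationRing

/-! ### The universal property -/

theorem ProjectivelyEquivalent.symm {ι A : Type*} [CommRing A] {v w : ι → Fin 3 → A}
    (h : ProjectivelyEquivalent v w) : ProjectivelyEquivalent w v := by
  obtain ⟨g, c, h⟩ := h
  refine ⟨g⁻¹, fun i => (c i)⁻¹, fun i => ?_⟩
  have hg : ((g⁻¹ : GL (Fin 3) A) : Matrix (Fin 3) (Fin 3) A) * g = 1 := g.inv_mul
  rw [h, Matrix.mulVec_smul, Matrix.mulVec_mulVec, hg, Matrix.one_mulVec, smul_smul,
    Units.inv_mul, one_smul]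

theorem ProjectivelyEquivalent.trans {ι A : Type*} [CommRing A] {v w x : ι → Fin 3 → A}
    (h : ProjectivelyEquivalent v w) (h' : ProjectivelyEquivalent w x) :
    ProjectivelyEquivalent v x := by
  obtain ⟨g, c, h⟩ := h
  obtain ⟨g', c', h'⟩ := h'
  refine ⟨g' * g, fun i => c' i * c i, fun i => ?_⟩
  rw [h', h, Matrix.mulVec_smul, Matrix.mulVec_mulVec, smul_smul, Units.val_mul, Units.val_mul]

theorem ProjectivelyEquivalent.comp {ι κ A : Type*} [CommRing A] {v w : ι → Fin 3 → A}
    (h : ProjectivelyEquivalent v w) (f : κ → ι) : ProjectivelyEquivalent (v ∘ f) (w ∘ f) := by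
  obtain ⟨g, c, h⟩ := h
  exact ⟨g, c ∘ f, fun i => h (f i)⟩

theorem ProjectivelyEquivalent.isAffineRealization {V A : Type*} [AddCommGroup V] [CommRing A]
    {p q : V → Fin 3 → A} (h : ProjectivelyEquivalent p q) (hp : IsAffineRealization p) :
    IsAffineRealization q := by
  obtain ⟨g, c, h⟩ := h
  obtain rfl : q = fun i => (c i : A) • (g : Matrix (Fin 3) (Fin 3) A).mulVec (p i) := funext h
  exact (hp.mulVec g).smul c

theorem span_range_crossProduct_eq_top {A : Type*} [CommRing A] {a b c : Fin 3 → A}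
    (h : IsUnit (det3 a b c)) : Ideal.span (Set.range (crossProduct a b)) = ⊤ := by
  refine Ideal.eq_top_of_isUnit_mem _ ?_ h
  have : det3 a b c = c 0 * crossProduct a b 0 + c 1 * crossProduct a b 1 +
      c 2 * crossProduct a b 2 := by
    simp [det3_apply, cross_apply]
    ring
  rw [this]
  have hm : ∀ i, c i * crossProduct a b i ∈ Ideal.span (Set.range (crossProduct a b)) :=
    fun i => Ideal.mul_mem_left _ _ (Ideal.subset_span ⟨i, rfl⟩)
  exact Ideal.add_mem _ (Ideal.add_mem _ (hm 0) (hm 1)) (hm 2)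

/-- The realizations of `M_27` are those of the truncation of `AG(3, 3)`. -/
theorem isRealization_cuspidalMatroid_iff {F A : Type*} [Field F] [CommRing A]
    (e : F ≃+ AffineSpace27) {v : F → Fin 3 → A} :
    IsRealization (cuspidalMatroid F) v ↔ IsAffineRealization (v ∘ e.symm) := by
  have hsum : ∀ i j l : F, i + j + l = 0 ↔ e i + e j + e l = 0 := fun i j l => by
    rw [← map_add, ← map_add, map_eq_zero_iff e e.injective]
  constructor
  · intro h
    have hmem : ∀ i j l, i ≠ j → j ≠ l → i ≠ l →
        ({e.symm i, e.symm j, e.symm l} ∈ cuspidalMatroid F ↔ i + j + l = 0) := by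
      intro i j l h₁ h₂ h₃
      rw [triple_mem_cuspidalMatroid_iff (e.symm.injective.ne h₁) (e.symm.injective.ne h₂)
        (e.symm.injective.ne h₃), hsum]
      simp
    exact ⟨fun i j l h₁ h₂ h₃ h₀ => h.concurrent _ _ _ (e.symm.injective.ne h₁)
        (e.symm.injective.ne h₂) (e.symm.injective.ne h₃) ((hmem i j l h₁ h₂ h₃).2 h₀),
      fun i j l h₁ h₂ h₃ h₀ => h.nonconcurrent _ _ _ (e.symm.injective.ne h₁)
        (e.symm.injective.ne h₂) (e.symm.injective.ne h₃) (by rwa [hmem i j l h₁ h₂ h₃])⟩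
  · intro h
    have h' := h.comp e.toAddMonoidHom e.injective
    have hv : (v ∘ e.symm) ∘ e.toAddMonoidHom = v := by
      funext t
      simp
    rw [hv] at h'
    refine ⟨fun i j hij => ?_, fun i j l h₁ h₂ h₃ h₀ => h'.collinear i j l h₁ h₂ h₃
        ((triple_mem_cuspidalMatroid_iff h₁ h₂ h₃).1 h₀),
      fun i j l h₁ h₂ h₃ h₀ => h'.noncollinear i j l h₁ h₂ h₃
        (fun h0 => h₀ ((triple_mem_cuspidalMatroid_iff h₁ h₂ h₃).2 h0))⟩
    obtain ⟨r, hri, hrj, hr⟩ : ∃ r, r ≠ e i ∧ r ≠ e j ∧ e i + e j + r ≠ 0 := by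
      have : ∀ s t : AffineSpace27, ∃ r, r ≠ s ∧ r ≠ t ∧ s + t + r ≠ 0 := by decide
      exact this _ _
    refine span_range_crossProduct_eq_top (h'.noncollinear i j (e.symm r) hij ?_ ?_ ?_)
    · rintro rfl
      simp at hrj
    · rintro rfl
      simp at hri
    · rw [Ne, hsum, e.apply_symm_apply]
      exact hr

theorem isRealizationSpace_realizationRing.{u} {k : Type u} [Field k] {F : Type*} [Field F]
    (κ : ZMod 3 →+* k) (e : F ≃+ AffineSpace27) :
    IsRealizationSpace k (cuspidalMatroid F) (RealizationRing κ) := by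
  have hself : ∀ {X : Type u} (v : F → X), (v ∘ e.symm) ∘ e = v := fun v => by
    funext t
    simp
  have hself' : ∀ {X : Type u} (v : AffineSpace27 → X), (v ∘ e) ∘ e.symm = v := fun v => by
    funext t
    simp
  refine ⟨RealizationRing.universal κ ∘ e, ?_, fun A _ _ v hv => ?_⟩
  · rw [isRealization_cuspidalMatroid_iff e, hself']
    exact RealizationRing.isAffineRealization_universal κ
  rw [isRealization_cuspidalMatroid_iff e] at hv
  let κ' : ZMod 3 →+* A := (algebraMap k A).comp κ
  -- the specialization of the universal realization along a homomorphism is a normal form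
  have hspec : ∀ ψ : RealizationRing κ →ₐ[k] A,
      (fun i x => ψ ((RealizationRing.universal κ ∘ e) i x)) =
        normalForm κ' (ψ (RealizationRing.coord κ 0)) (ψ (RealizationRing.coord κ 1))
          (ψ (RealizationRing.coord κ 2)) (ψ (RealizationRing.eps κ)) ∘ e := fun ψ => by
    funext i
    exact map_normalForm ψ.toRingHom _ κ' _ _ _ _ (e i)
  obtain ⟨u, v', w, ε, h2, hw, hequiv⟩ := hv.exists_normalForm κ'
  have hnf : IsAffineRealization (normalForm κ' u v' w ε) :=
    ProjectivelyEquivalent.isAffineRealization hequiv hv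
  obtain ⟨φ, rfl, rfl, rfl, rfl⟩ := RealizationRing.exists_algHom (κ := κ) h2 hw hnf
  refine ⟨φ, ?_, fun ψ hψ => ?_⟩
  · simp only
    rw [hspec]
    have := (ProjectivelyEquivalent.symm hequiv).comp e
    rwa [hself] at this
  · simp only at hψ
    rw [hspec] at hψ
    have hψ' := hψ.comp e.symm
    rw [hself'] at hψ'
    have hε : ψ (RealizationRing.eps κ) ^ 2 = 0 := by
      rw [← map_pow, RealizationRing.eps_sq, map_zero]
    obtain ⟨h0, h1, h2', h3⟩ := normalForm_unique
      (hψ'.symm.isAffineRealization hv) hε h2 (hψ'.trans hequiv)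
    refine RealizationRing.algHom_ext (fun i => ?_) h3
    fin_cases i
    exacts [h0, h1, h2']

/-! ### Dimensions -/

/-- If `1, α, β` are linearly independent over `𝔽₃`, then the affine map with slopes `α, β`
realizes the truncation of `AG(3, 3)`. -/
theorem isAffineRealization_of_linearIndependent {k : Type*} [Field k] {κ : ZMod 3 →+* k} {α β : k}
    (h : ∀ a b c : ZMod 3, κ a + κ b * α + κ c * β = 0 → a = 0 ∧ b = 0 ∧ c = 0) :
    IsAffineRealization (normalForm κ α β 0 0) := by
  refine ⟨fun i j l _ _ _ h₀ => det3_normalForm_eq_zero (by simp) (by simp) h₀,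
    fun i j l hij hjl hil h₀ => isUnit_iff_ne_zero.2 fun hdet => ?_⟩
  have key : ∀ a b c x y z : ZMod 3, a * y - b * x = 0 ∧ c * y - b * z = 0 ∧
      a * z - c * x = 0 → (a, b, c) = 0 ∨ (x, y, z) = 0 ∨ (a, b, c) = (x, y, z) ∨
        (a, b, c) + (x, y, z) = 0 := by decide
  have hm := h ((j - i).1 * (l - i).2.1 - (j - i).2.1 * (l - i).1)
    ((j - i).2.2 * (l - i).2.1 - (j - i).2.1 * (l - i).2.2)
    ((j - i).1 * (l - i).2.2 - (j - i).2.2 * (l - i).1) (by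
      rw [← hdet, det3_apply]
      simp [normalForm, firstCoord, secondCoord, thirdCoord]
      ring)
  rcases key _ _ _ _ _ _ hm with h₁ | h₁ | h₁ | h₁
  · exact hij (sub_eq_zero.1 h₁).symm
  · exact hil (sub_eq_zero.1 h₁).symm
  · exact hjl (sub_left_injective h₁)
  · change (j - i) + (l - i) = 0 at h₁
    apply h₀
    rw [← h₁, ← sub_eq_zero, ← AffineSpace27.add_add_self i]
    abel

theorem exists_linearIndependent_over_three {k : Type*} [Field k] [Infinite k] (κ : ZMod 3 →+* k) :
    ∃ α β : k, ∀ a b c : ZMod 3, κ a + κ b * α + κ c * β = 0 → a = 0 ∧ b = 0 ∧ c = 0 := by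
  obtain ⟨α, hα⟩ := (Set.finite_range κ).exists_notMem
  obtain ⟨β, hβ⟩ := (Set.finite_range fun x : ZMod 3 × ZMod 3 => κ x.1 + κ x.2 * α).exists_notMem
  have : Fact (Nat.Prime 3) := ⟨Nat.prime_three⟩
  refine ⟨α, β, fun a b c h => ?_⟩
  have hc : c = 0 := by
    by_contra hc
    have hκ : κ c * κ c⁻¹ = 1 := by rw [← map_mul, mul_inv_cancel₀ hc, map_one]
    refine hβ ⟨(-(c⁻¹ * a), -(c⁻¹ * b)), ?_⟩
    simp only [map_neg, map_mul]
    linear_combination -κ c⁻¹ * h + β * hκ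
  subst hc
  have hb : b = 0 := by
    by_contra hb
    have hκ : κ b * κ b⁻¹ = 1 := by rw [← map_mul, mul_inv_cancel₀ hb, map_one]
    refine hα ⟨-(b⁻¹ * a), ?_⟩
    simp only [map_neg, map_mul]
    rw [map_zero] at h
    linear_combination -κ b⁻¹ * h + α * hκ
  subst hb
  refine ⟨?_, rfl, rfl⟩
  simpa using h

section Dimension

variable {k : Type*} [Field k] {κ : ZMod 3 →+* k}

theorem eval_degeneracy_ne_zero {α β : k} (h : IsAffineRealization (normalForm κ α β 0 0)) :
    eval ![α, β, 0] (degeneracy κ) ≠ 0 :=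
  ((isUnit_map_degeneracy_iff κ (eval ![α, β, 0]) κ).2 (by simpa using h)).ne_zero

theorem degeneracy_ne_zero [Infinite k] : degeneracy κ ≠ 0 := by
  obtain ⟨α, β, h⟩ := exists_linearIndependent_over_three κ
  intro h0
  apply eval_degeneracy_ne_zero (isAffineRealization_of_linearIndependent h)
  rw [h0, map_zero]

theorem isDomain_projectionRing [Infinite k] : IsDomain (ProjectionRing κ) :=
  IsLocalization.isDomain_localization
    (powers_le_nonZeroDivisors_of_noZeroDivisors degeneracy_ne_zero)

theorem affineLocus_eq_map :
    affineLocus κ = (Ideal.span {(X 2 : MvPolynomial (Fin 3) k)}).map (algebraMap _ _) := by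
  rw [Ideal.map_span, Set.image_singleton]
  rfl

/-- The locus `w = 0` is irreducible of dimension `2` in the space of projections, which has
dimension `3`. -/
theorem affineLocus_facts [Infinite k] : (affineLocus κ).IsPrime ∧ affineLocus κ ≠ ⊥ ∧
    ringKrullDim (ProjectionRing κ) = 3 ∧ ringKrullDim (ProjectionRing κ ⧸ affineLocus κ) = 2 := by
  have hdom := isDomain_projectionRing (κ := κ)
  obtain ⟨α, β, hαβ⟩ := exists_linearIndependent_over_three κ
  have hf := eval_degeneracy_ne_zero (isAffineRealization_of_linearIndependent hαβ)
  -- a chain of primes at the point `(α, β, 0)`, which is not degenerate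
  let θ : MvPolynomial (Fin 3) k →ₐ[k] MvPolynomial (Fin 3) k := aeval ![X 0, C β, 0]
  let p₂ : Ideal (MvPolynomial (Fin 3) k) := Ideal.span {X 2}
  let p₁ : Ideal (MvPolynomial (Fin 3) k) := RingHom.ker θ
  let p₀ : Ideal (MvPolynomial (Fin 3) k) := RingHom.ker (eval ![α, β, 0])
  have hp₂ : p₂.IsPrime := (Ideal.span_singleton_prime (X_ne_zero 2)).2 X_prime
  have hp₁ : p₁.IsPrime := RingHom.ker_isPrime _
  have hp₀ : p₀.IsPrime := RingHom.ker_isPrime _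
  have h₂₁ : p₂ ≤ p₁ := by
    rw [Ideal.span_singleton_le_iff_mem, RingHom.mem_ker]
    simp [θ]
  have h₁₀ : p₁ ≤ p₀ := by
    intro x hx
    have hx : θ x = 0 := hx
    have : (aeval ![α, β, 0]).comp θ = (aeval ![α, β, 0] : MvPolynomial (Fin 3) k →ₐ[k] k) := by
      refine MvPolynomial.algHom_ext fun i => ?_
      fin_cases i <;> simp [θ]
    have h := congrArg (fun f => f x) this
    simp only [AlgHom.comp_apply, hx, map_zero] at h
    exact h.symm
  have hdisj₀ : Disjoint (Submonoid.powers (degeneracy κ) : Set (MvPolynomial (Fin 3) k)) p₀ := by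
    rw [Set.disjoint_left]
    rintro _ ⟨n, rfl⟩ hn
    exact hf (hp₀.mem_of_pow_mem n hn)
  have hdisj₁ := hdisj₀.mono_right (SetLike.coe_subset_coe.2 h₁₀)
  have hdisj₂ := hdisj₁.mono_right (SetLike.coe_subset_coe.2 h₂₁)
  let S := ProjectionRing κ
  have prime : ∀ {p : Ideal (MvPolynomial (Fin 3) k)}, p.IsPrime →
      Disjoint (Submonoid.powers (degeneracy κ) : Set (MvPolynomial (Fin 3) k)) p →
      (p.map (algebraMap _ S)).IsPrime := fun hp hd =>
    IsLocalization.isPrime_of_isPrime_disjoint (Submonoid.powers (degeneracy κ)) S _ hp hd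
  have lt : ∀ {p q : Ideal (MvPolynomial (Fin 3) k)}, p.IsPrime → q.IsPrime →
      Disjoint (Submonoid.powers (degeneracy κ) : Set (MvPolynomial (Fin 3) k)) p →
      Disjoint (Submonoid.powers (degeneracy κ) : Set (MvPolynomial (Fin 3) k)) q →
      p ≤ q → ∀ {x}, x ∈ q → x ∉ p → p.map (algebraMap _ S) < q.map (algebraMap _ S) := by
    intro p q hp hq hdp hdq hpq x hxq hxp
    refine lt_of_le_of_ne (Ideal.map_mono hpq) fun h => hxp ?_
    rw [← IsLocalization.under_map_of_isPrime_disjoint (Submonoid.powers (degeneracy κ)) S hp hdp,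
      h, IsLocalization.under_map_of_isPrime_disjoint (Submonoid.powers (degeneracy κ)) S hq hdq]
    exact hxq
  have hP₂ := prime hp₂ hdisj₂
  have hP₁ := prime hp₁ hdisj₁
  have hP₀ := prime hp₀ hdisj₀
  have l₂₁ := lt hp₂ hp₁ hdisj₂ hdisj₁ h₂₁ (x := X 1 - C β) (by
    rw [RingHom.mem_ker]
    simp [θ]) (by
    rw [Ideal.mem_span_singleton]
    intro hd
    have := map_dvd (eval ![0, β + 1, 0]) hd
    simp at this)
  have l₁₀ := lt hp₁ hp₀ hdisj₁ hdisj₀ h₁₀ (x := X 0 - C α) (by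
    rw [RingHom.mem_ker]
    simp) (by
    rw [RingHom.mem_ker]
    intro hd
    have := congrArg (eval ![α + 1, 0, 0]) hd
    simp [θ] at this)
  have hbot : (⊥ : Ideal S) < p₂.map (algebraMap _ S) := by
    have := lt (p := ⊥) Ideal.isPrime_bot hp₂ (by
      rw [Set.disjoint_left]
      rintro _ ⟨n, rfl⟩ hn
      exact pow_ne_zero n degeneracy_ne_zero hn) hdisj₂ bot_le (x := X 2)
      (Ideal.mem_span_singleton_self _) (X_ne_zero 2)
    rwa [Ideal.map_bot] at this
  have d₀ : 0 ≤ ringKrullDim (S ⧸ p₀.map (algebraMap _ S)) := by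
    have := Ideal.Quotient.nontrivial_iff.2 hP₀.ne_top
    exact ringKrullDim_nonneg_of_nontrivial
  have d₁ := ringKrullDim_quotient_add_one_le l₁₀
  have d₂ := ringKrullDim_quotient_add_one_le l₂₁
  have d₃ := ringKrullDim_quotient_add_one_le hbot
  have d₄ : ringKrullDim (S ⧸ (⊥ : Ideal S)) ≤ 3 := by
    rw [ringKrullDim_eq_of_ringEquiv (RingEquiv.quotientBot S)]
    refine (ringKrullDim_le_of_isLocalization (Submonoid.powers (degeneracy κ))).trans ?_
    rw [MvPolynomial.ringKrullDim_of_isNoetherianRing]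
    simp
  rw [affineLocus_eq_map]
  have c₁ : 1 ≤ ringKrullDim (S ⧸ p₁.map (algebraMap _ S)) :=
    le_trans (by simpa using add_le_add_left d₀ 1) d₁
  have c₂ : 2 ≤ ringKrullDim (S ⧸ p₂.map (algebraMap _ S)) :=
    le_trans (le_trans (by norm_num) (add_le_add_left c₁ 1)) d₂
  have c₃ : 3 ≤ ringKrullDim (S ⧸ (⊥ : Ideal S)) :=
    le_trans (le_trans (by norm_num) (add_le_add_left c₂ 1)) d₃
  refine ⟨hP₂, hbot.ne', ?_, le_antisymm ?_ c₂⟩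
  · rw [← ringKrullDim_eq_of_ringEquiv (RingEquiv.quotientBot S)]
    exact le_antisymm d₄ c₃
  · have : ringKrullDim (S ⧸ p₂.map (algebraMap _ S)) + (1 : ℕ) ≤ 2 + (1 : ℕ) := by
      refine (d₃.trans d₄).trans ?_
      norm_num
    exact (ENat.WithBot.add_le_add_natCast_right_iff).1 this

end Dimension

/-! ### An affine chart of a quadric cone -/

theorem MvPolynomial.IsHomogeneous.eval₂_mul {σ R B : Type*} [CommSemiring R] [CommSemiring B]
    {p : MvPolynomial σ R} {n : ℕ} (hp : p.IsHomogeneous n) (f : R →+* B) (g : σ → B) (c : B) :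
    p.eval₂ f (fun i => c * g i) = c ^ n * p.eval₂ f g := by
  rw [eval₂_eq, eval₂_eq, Finset.mul_sum]
  refine Finset.sum_congr rfl fun s hs => ?_
  have hn : ∑ i ∈ s.support, s i = n := by
    rw [← hp (mem_support_iff.1 hs), show (1 : σ → ℕ) = fun _ => 1 from rfl,
      ← Finsupp.degree_eq_weight_one]
    rfl
  simp only [mul_pow, Finset.prod_mul_distrib, Finset.prod_pow_eq_pow_sum, hn]
  ring

theorem Localization.mk_pow_eq {A : Type*} [CommRing A] (x a : A) (n : ℕ)
    (h : x ^ n ∈ Submonoid.powers x) : Localization.mk a ⟨x ^ n, h⟩ =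
      Localization.mk 1 ⟨x, Submonoid.mem_powers x⟩ ^ n * algebraMap A (Localization.Away x) a := by
  rw [← Localization.mk_one_eq_algebraMap, Localization.mk_pow, Localization.mk_mul, one_pow,
    one_mul, mul_one]
  rfl

section Quadric

variable {k : Type*} [Field k]

/-- The matrix of the quadratic form `2 x₀ x₁ + x₂²` in five variables. -/
def coneMatrix (k : Type*) [Field k] : Matrix (Fin 5) (Fin 5) k :=
  !![0, 1, 0, 0, 0; 1, 0, 0, 0, 0; 0, 0, 1, 0, 0; 0, 0, 0, 0, 0; 0, 0, 0, 0, 0]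

theorem isSymm_coneMatrix : (coneMatrix k).IsSymm := by
  ext i j
  fin_cases i <;> fin_cases j <;> rfl

theorem rank_coneMatrix : (coneMatrix k).rank = 3 := by
  classical
  let P : Matrix (Fin 5) (Fin 5) k :=
    !![0, 1, 0, 0, 0; 1, 0, 0, 0, 0; 0, 0, 1, 0, 0; 0, 0, 0, 1, 0; 0, 0, 0, 0, 1]
  have h : coneMatrix k = Matrix.diagonal ![1, 1, 1, 0, 0] * P := by
    ext i j
    fin_cases i <;> fin_cases j <;> simp [coneMatrix, P, Matrix.diagonal_mul]
  have hP : IsUnit P.det := by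
    refine Matrix.isUnit_det_of_right_inverse (B := P) ?_
    ext i j
    fin_cases i <;> fin_cases j <;> simp [P, Matrix.mul_apply, Fin.sum_univ_five]
  rw [h, Matrix.rank_mul_eq_left_of_isUnit_det _ _ hP, Matrix.rank_diagonal, Fintype.card_subtype,
    Finset.card_filter, Fin.sum_univ_five]
  simp

theorem quadraticPoly_coneMatrix (h3 : (3 : k) = 0) :
    quadraticPoly (coneMatrix k) = X 2 ^ 2 - X 0 * X 1 := by
  have : (3 : MvPolynomial (Fin 5) k) = 0 := by
    rw [← map_ofNat C 3, h3, C_0]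
  simp [quadraticPoly, Fin.sum_univ_five, coneMatrix]
  linear_combination X 0 * X 1 * this

/-- The homogeneous coordinates of the point of the chart `x₀ ≠ 0` of the cone `x₂² = x₀ x₁` with
affine coordinates `x₂, x₃, x₄`. -/
noncomputable def chartPoint (k : Type*) [Field k] : Fin 5 → MvPolynomial (Fin 3) k :=
  ![1, X 0 ^ 2, X 0, X 1, X 2]

/-- The substitution of `chartPoint` in the homogeneous coordinate ring of the cone. -/
noncomputable def coneToChart (h3 : (3 : k) = 0) :
    QuadricRing (coneMatrix k) →ₐ[k] MvPolynomial (Fin 3) k :=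
  Ideal.Quotient.liftₐ _ (aeval (chartPoint k)) fun a ha => by
    obtain ⟨b, rfl⟩ := Ideal.mem_span_singleton'.1 ha
    rw [map_mul, quadraticPoly_coneMatrix h3]
    simp [chartPoint]

/-- The homogeneous coordinates on the cone. -/
noncomputable def coneCoord (k : Type*) [Field k] (i : Fin 5) : QuadricRing (coneMatrix k) :=
  Ideal.Quotient.mkₐ k _ (X i)

theorem coneToChart_mk (h3 : (3 : k) = 0) (p : MvPolynomial (Fin 5) k) :
    coneToChart h3 (Ideal.Quotient.mkₐ k _ p) = aeval (chartPoint k) p := by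
  rfl

theorem coneCoord_mem (i : Fin 5) : coneCoord k i ∈ quadricGrading (coneMatrix k) 1 :=
  ⟨X i, isHomogeneous_X k i, rfl⟩

/-- The coordinate ring of the chart `x₀ ≠ 0` of the cone. -/
abbrev ConeChart (k : Type*) [Field k] : Type _ :=
  HomogeneousLocalization.Away (quadricGrading (coneMatrix k)) (coneCoord k 0)

/-- The scalars in the coordinate ring of the chart. -/
noncomputable def coneChartC (k : Type*) [Field k] : k →+* ConeChart k :=
  (HomogeneousLocalization.fromZeroRingHom (quadricGrading (coneMatrix k))
    (Submonoid.powers (coneCoord k 0))).comp (algebraMap k (quadricGrading (coneMatrix k) 0))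

/-- The functions `xᵢ / x₀` on the chart. -/
noncomputable def coneRatio (k : Type*) [Field k] (i : Fin 5) : ConeChart k :=
  HomogeneousLocalization.Away.mk _ (coneCoord_mem 0) 1 (coneCoord k i) (coneCoord_mem i)

theorem coneRatio_zero : coneRatio k 0 = 1 := by
  apply HomogeneousLocalization.val_injective
  simp [coneRatio, HomogeneousLocalization.val_one]

theorem coneRatio_two_sq (h3 : (3 : k) = 0) : coneRatio k 2 ^ 2 = coneRatio k 1 := by
  have h : coneCoord k 2 ^ 2 = coneCoord k 0 * coneCoord k 1 := by
    rw [coneCoord, coneCoord, coneCoord, ← map_pow, ← map_mul, ← sub_eq_zero, ← map_sub,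
      ← quadraticPoly_coneMatrix h3]
    exact Ideal.Quotient.eq_zero_iff_mem.2 (Ideal.mem_span_singleton_self _)
  apply HomogeneousLocalization.val_injective
  simp only [coneRatio, HomogeneousLocalization.val_pow, HomogeneousLocalization.Away.val_mk,
    Localization.mk_pow, h, Localization.mk_eq_mk_iff, Localization.r_iff_exists]
  refine ⟨1, ?_⟩
  simp
  ring

/-- The chart `x₀ ≠ 0` of the cone is an affine space with coordinates `xᵢ / x₀`, `i = 2, 3, 4`. -/
noncomputable def affineToConeChart (k : Type*) [Field k] :
    MvPolynomial (Fin 3) k →+* ConeChart k :=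
  eval₂Hom (coneChartC k) ![coneRatio k 2, coneRatio k 3, coneRatio k 4]

theorem affineToConeChart_C (a : k) : affineToConeChart k (C a) = coneChartC k a :=
  eval₂Hom_C _ _ _

theorem affineToConeChart_aeval (h3 : (3 : k) = 0) (p : MvPolynomial (Fin 5) k) :
    affineToConeChart k (aeval (chartPoint k) p) = eval₂ (coneChartC k) (coneRatio k) p := by
  have : (affineToConeChart k).comp (aeval (chartPoint k)).toRingHom =
      eval₂Hom (coneChartC k) (coneRatio k) := by
    refine MvPolynomial.ringHom_ext (fun a => ?_) fun i => ?_
    · simp [affineToConeChart_C]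
    · fin_cases i <;> simp [affineToConeChart, chartPoint, coneRatio_zero, coneRatio_two_sq h3]
  exact congrArg (fun f => f p) this

theorem coneChartC_eq (a : k) (ha : algebraMap k (QuadricRing (coneMatrix k)) a ∈
      quadricGrading (coneMatrix k) (0 • 1)) :
    coneChartC k a = HomogeneousLocalization.Away.mk _ (coneCoord_mem 0) 0 _ ha := by
  apply HomogeneousLocalization.val_injective
  rfl

theorem affineToConeChart_bijective (h3 : (3 : k) = 0) :
    Function.Bijective (affineToConeChart k) := by
  have h0 : coneToChart h3 (coneCoord k 0) * 1 = 1 := by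
    rw [coneCoord, coneToChart_mk]
    simp [chartPoint]
  let g : ConeChart k →+* MvPolynomial (Fin 3) k :=
    (Localization.awayLift (coneToChart h3).toRingHom (coneCoord k 0)
      (isUnit_iff_exists_inv.2 ⟨1, h0⟩)).comp (algebraMap (ConeChart k) _)
  have hg : ∀ n a ha, g (HomogeneousLocalization.Away.mk _ (coneCoord_mem 0) n a ha) =
      coneToChart h3 a := by
    intro n a ha
    have := Localization.awayLift_mk (coneToChart h3).toRingHom (coneCoord k 0) a 1 h0 n
    rw [one_pow, mul_one] at this
    exact this
  have hinj : g.comp (affineToConeChart k) = RingHom.id _ := by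
    refine MvPolynomial.ringHom_ext (fun a => ?_) fun i => ?_
    · have hmem : algebraMap k (QuadricRing (coneMatrix k)) a ∈
          quadricGrading (coneMatrix k) (0 • 1) :=
        (algebraMap k (quadricGrading (coneMatrix k) 0) a).2
      rw [RingHom.comp_apply, affineToConeChart_C, coneChartC_eq a hmem, hg]
      exact (coneToChart h3).commutes a
    · have hr : ∀ i, g (coneRatio k i) = chartPoint k i := fun i =>
        (hg _ _ _).trans ((coneToChart_mk h3 (X i)).trans (aeval_X _ i))
      fin_cases i <;> simp [affineToConeChart, hr, chartPoint]
  refine ⟨Function.LeftInverse.injective (g := g) fun x => congrArg (fun f => f x) hinj, ?_⟩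
  intro z
  obtain ⟨n, _, ⟨p, hp, rfl⟩, rfl⟩ :=
    HomogeneousLocalization.Away.mk_surjective _ (coneCoord_mem (k := k) 0) z
  refine ⟨aeval (chartPoint k) p, ?_⟩
  rw [affineToConeChart_aeval h3]
  apply HomogeneousLocalization.val_injective
  let A := QuadricRing (coneMatrix k)
  let B := Localization.Away (coneCoord k 0)
  let m : MvPolynomial (Fin 5) k →+* A := Ideal.Quotient.mk _
  let c : B := Localization.mk 1 ⟨coneCoord k 0, Submonoid.mem_powers _⟩
  have h₁ : (algebraMap (ConeChart k) B).comp (coneChartC k) =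
      ((algebraMap A B).comp m).comp C := by
    ext a
    rfl
  have h₂ : algebraMap (ConeChart k) B ∘ coneRatio k =
      fun i => c * (((algebraMap A B).comp m) ∘ X) i := by
    ext i
    exact (Localization.mk_pow_eq (coneCoord k 0) (coneCoord k i) 1 ⟨1, rfl⟩).trans
      (by rw [pow_one]; rfl)
  have h := eval₂_comp_left (algebraMap (ConeChart k) B) (coneChartC k) (coneRatio k) p
  rw [h₁, h₂, IsHomogeneous.eval₂_mul hp, ← eval₂_comp_left, eval₂_eta] at h
  rw [smul_eq_mul, mul_one] at h
  exact h.trans (Localization.mk_pow_eq (coneCoord k 0) (m p) n ⟨n, rfl⟩).symm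

end Quadric

/-- A principal open subset of affine space, embedded in the quadric cone through the chart
`x₀ ≠ 0`. -/
theorem exists_isOpenImmersion_projQuadric.{u} {k : Type u} [Field k] (h3 : (3 : k) = 0)
    (f : MvPolynomial (Fin 3) k) {R : Type u} [CommRing R] [Algebra k R]
    (e : Localization.Away f ≃ₐ[k] R) :
    ∃ j : Spec (CommRingCat.of R) ⟶ projQuadric (coneMatrix k), IsOpenImmersion j ∧
      j ≫ projQuadricToSpec (coneMatrix k) =
        Spec.map (CommRingCat.ofHom (algebraMap k R)) := by
  let c : ConeChart k ≃+* MvPolynomial (Fin 3) k :=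
    (RingEquiv.ofBijective _ (affineToConeChart_bijective h3)).symm
  let j₁ : Spec (CommRingCat.of R) ⟶ Spec (CommRingCat.of (Localization.Away f)) :=
    Spec.map e.toRingEquiv.toCommRingCatIso.hom
  let j₂ : Spec (CommRingCat.of (Localization.Away f)) ⟶
      Spec (CommRingCat.of (MvPolynomial (Fin 3) k)) :=
    Spec.map (CommRingCat.ofHom (algebraMap _ _))
  let j₃ : Spec (CommRingCat.of (MvPolynomial (Fin 3) k)) ⟶ Spec (CommRingCat.of (ConeChart k)) :=
    Spec.map c.toCommRingCatIso.hom
  let j₄ : Spec (CommRingCat.of (ConeChart k)) ⟶ projQuadric (coneMatrix k) :=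
    Proj.awayι (quadricGrading (coneMatrix k)) _ (coneCoord_mem 0) one_pos
  have h₂ : IsOpenImmersion j₂ := IsOpenImmersion.of_isLocalization f
  have h₄ : IsOpenImmersion j₄ := by
    dsimp only [j₄, projQuadric]
    infer_instance
  refine ⟨j₁ ≫ j₂ ≫ j₃ ≫ j₄, inferInstance, ?_⟩
  have h : j₄ ≫ projQuadricToSpec (coneMatrix k) =
      Spec.map (CommRingCat.ofHom (coneChartC k)) := by
    have h := congrArg (· ≫ Spec.map (CommRingCat.ofHom
      (algebraMap k (quadricGrading (coneMatrix k) 0))))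
      (Proj.awayι_toSpecZero (quadricGrading (coneMatrix k)) _ (coneCoord_mem 0) one_pos)
    simp only [Category.assoc, ← Spec.map_comp] at h
    exact h
  simp only [Category.assoc]
  rw [h, ← Spec.map_comp, ← Spec.map_comp, ← Spec.map_comp]
  congr 1
  ext a
  have hc : c (coneChartC k a) = C a := by
    rw [← affineToConeChart_C]
    exact (RingEquiv.ofBijective _ (affineToConeChart_bijective h3)).symm_apply_apply _
  change e (algebraMap _ _ (c (coneChartC k a))) = _
  rw [hc]
  exact e.commutes a

/-- The reduction of the realization space is the space of projections. -/
noncomputable def projectionRingEquiv {k : Type*} [Field k] [Infinite k] (κ : ZMod 3 →+* k) :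
    ProjectionRing κ ≃ₐ[k] RealizationRing κ ⧸ nilradical (RealizationRing κ) :=
  have := isDomain_projectionRing (κ := κ)
  AlgEquiv.ofBijective
    ((Ideal.Quotient.mkₐ k _).comp (TrivSqZeroExt.inlAlgHom k _ _)) <| by
      constructor
      · rw [injective_iff_map_eq_zero]
        intro a ha
        have ha : TrivSqZeroExt.inl a ∈ nilradical (RealizationRing κ) :=
          Ideal.Quotient.eq_zero_iff_mem.1 ha
        rw [TrivSqZeroExt.nilradical_eq_kerIdeal] at ha
        exact ha
      · intro y
        obtain ⟨x, rfl⟩ := Ideal.Quotient.mk_surjective y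
        refine ⟨x.fst, ?_⟩
        change Ideal.Quotient.mk _ (TrivSqZeroExt.inl x.fst) = _
        rw [Ideal.Quotient.eq, TrivSqZeroExt.nilradical_eq_kerIdeal]
        change (TrivSqZeroExt.inl x.fst - x).fst = 0
        simp

theorem theorem1 :
    -- the arrangement of `q` lines: its only singularities are `q (q - 1) / 6` triple points
    (∀ (n : ℕ) (F : Type) [Field F], 1 ≤ n → Nat.card F = 3 ^ n →
      Function.Injective (cuspidalArrangement F) ∧
      6 * {P | (linesThrough (cuspidalArrangement F) P).ncard = 3}.ncard = 3 ^ n * (3 ^ n - 1) ∧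
      ∀ P, 2 ≤ (linesThrough (cuspidalArrangement F) P).ncard →
        (linesThrough (cuspidalArrangement F) P).ncard = 3) ∧
    -- for `q = 3 ^ n`, `n ≥ 3`, there are no realizations in characteristic different from `3`
    (∀ (n : ℕ) (F : Type) [Field F], 3 ≤ n → Nat.card F = 3 ^ n →
      ∀ (K : Type*) [Field K], ringChar K ≠ 3 →
        ¬ ∃ L : F → ℙ K (Fin 3 → K), Realizes L (cuspidalMatroid F)) ∧
    -- the realization space `Spec R` of `M_27` over the algebraic closure of `𝔽_3`
    (∀ (F : Type) [Field F], Nat.card F = 27 →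
      ∃ (R : Type) (_ : CommRing R) (_ : Algebra (AlgebraicClosure (ZMod 3)) R),
        IsRealizationSpace (AlgebraicClosure (ZMod 3)) (cuspidalMatroid F) R ∧
        ringKrullDim R = 3 ∧
        (∃ Q : Ideal R, IsEmbeddedComponent Q ∧ ¬ Q.IsRadical ∧ ringKrullDim (R ⧸ Q) = 2) ∧
        ∃ (S : Matrix (Fin 5) (Fin 5) (AlgebraicClosure (ZMod 3)))
          (j : Spec (CommRingCat.of (R ⧸ nilradical R)) ⟶ projQuadric S),
          S.IsSymm ∧ S.rank = 3 ∧ IsOpenImmersion j ∧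
          j ≫ projQuadricToSpec S = Spec.map (CommRingCat.ofHom
            (algebraMap (AlgebraicClosure (ZMod 3)) (R ⧸ nilradical R)))) := by
  have : Fact (Nat.Prime 3) := ⟨Nat.prime_three⟩
  refine ⟨fun n F _ _ hF => ?_, fun n F _ hn hF K _ hK => ?_, fun F _ hF => ?_⟩
  · have := charP_three_of_card hF
    have : Finite F := Nat.finite_of_card_ne_zero (by rw [hF]; positivity)
    exact ⟨cuspidalArrangement_injective F, by rw [card_triplePoints, hF],
      fun P => ncard_linesThrough_cuspidalArrangement⟩
  · rintro ⟨L, hL⟩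
    exact hK (ringChar_eq_three_of_realizes hn hF hL)
  · obtain ⟨e⟩ := exists_addEquiv hF
    let κ := algebraMap (ZMod 3) (AlgebraicClosure (ZMod 3))
    have : Infinite (AlgebraicClosure (ZMod 3)) := inferInstance
    have := isDomain_projectionRing (κ := κ)
    obtain ⟨hprime, hbot, hdim, hdim'⟩ := affineLocus_facts (κ := κ)
    refine ⟨RealizationRing κ, inferInstance, inferInstance,
      isRealizationSpace_realizationRing κ e, ?_,
      ⟨TrivSqZeroExt.extendedIdeal (affineLocus κ),
        TrivSqZeroExt.isEmbeddedComponent_extendedIdeal _ hbot,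
        TrivSqZeroExt.not_isRadical_extendedIdeal _, ?_⟩, coneMatrix _, ?_⟩
    · rw [TrivSqZeroExt.ringKrullDim_eq, hdim]
    · rw [TrivSqZeroExt.ringKrullDim_quotient_extendedIdeal, hdim']
    · obtain ⟨j, hj, hj'⟩ := exists_isOpenImmersion_projQuadric (three_eq_zero_of_ringHom κ)
        (degeneracy κ) (R := RealizationRing κ ⧸ nilradical (RealizationRing κ))
        (projectionRingEquiv κ)
      exact ⟨j, isSymm_coneMatrix, rank_coneMatrix, hj, hj'⟩
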